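/- Let $n\ge 2$. On $\mathbb{R}^{1+n}=\{(t,x): t\in\mathbb{R},\ x\in\mathbb{R}^n\}$ put $r=|x|$, $u=\frac12(t-r)$, $v=\frac12(t+r)$, $\Box=-\partial_t^2+\Delta_x$, and let $\mathcal{D}=\{(t,x): |t|<r\}$. Let $\partial_u=\partial_t-\partial_r$ and $\partial_v=\partial_t+\partial_r$ be the derivatives in the $u$-$v$-spherical coordinates, and let $|\nabla\!\!\!\!/\,\phi|$ be the length of the component of the spatial gradient of $\phi$ tangent to the spheres of constant $(t,r)$. Let $1\le p<1+\frac{4}{n-1}$, let $V\in C^1(\mathcal{D})\cap L^\infty(\mathcal{D})$, and let the real-valued function $\phi\in C^2(\mathcal{D})$ satisfy $$\Box\phi+V|\phi|^{p-1}\phi=0\quad\text{on }\mathcal{D}.$$ Suppose that for some $\delta>0$ $$\sup_{\mathcal{D}}\Big\{[(1+|u|)(1+|v|)]^{\frac{n-1+\delta}{2}}\big(|u\,\partial_u\phi|+|v\,\partial_v\phi|\big)\Big\}<\infty,$$ $$\sup_{\mathcal{D}\cap\{|uv|<1\}}\Big\{[(1+|u|)(1+|v|)]^{\frac{n-1+\delta}{2}}|uv|^{\frac12}|\nabla\!\!\!\!/\,\phi|\Big\}<\infty,$$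 $$\sup_{\mathcal{D}}\Big\{[(1+|u|)(1+|v|)]^{\frac{n-1+\delta}{2}}|\phi|\Big\}<\infty,$$ $$\sup_{\mathcal{D}\cap\{|uv|>1\}}\Big\{[(1+|u|)(1+|v|)]^{\frac{n-1+\delta}{p+1}}|uv|^{\frac1{p+1}}V^{\frac1{p+1}}|\phi|\Big\}<\infty,$$ and that for some $\mu>0$, everywhere on $\mathcal{D}$, $$V>0,\qquad (u\partial_u+v\partial_v)(\log V)>-\frac{n-1}{2}\Big(1+\frac{4}{n-1}-p\Big)+\mu.$$ Then $\phi$ vanishes everywhere on $\mathcal{D}$. -/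

import Mathlib

noncomputable section

namespace UniqueContinuation

/-- The underlying space of `(1+n)`-dimensional Minkowski spacetime: points are `(t, x)` with
`t` real and `x` in `n`-dimensional Euclidean space. -/
abbrev Spacetime (n : ℕ) : Type := ℝ × EuclideanSpace ℝ (Fin n)

variable {n : ℕ}

/-- The null coordinate `u = (t - r) / 2`, where `r = |x|`. -/
def nullU (Q : Spacetime n) : ℝ := (Q.1 - ‖Q.2‖) / 2

/-- The null coordinate `v = (t + r) / 2`, where `r = |x|`. -/
def nullV (Q : Spacetime n) : ℝ := (Q.1 + ‖Q.2‖) / 2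

/-- The exterior `|t| < r` of the double null cone about the origin (an open set). -/
def exterior (n : ℕ) : Set (Spacetime n) := {Q | |Q.1| < ‖Q.2‖}

/-- The unit radial vector `x / |x|`, that is, the spatial part of the coordinate field `∂_r`. -/
def radialDir (Q : Spacetime n) : EuclideanSpace ℝ (Fin n) := ‖Q.2‖⁻¹ • Q.2

/-- The derivative `∂_u φ` in the `u`-`v`-spherical coordinates. Since `t = u + v` and
`r = v - u`, one has `∂_u = ∂_t - ∂_r`. -/
def partialU (φ : Spacetime n → ℝ) (Q : Spacetime n) : ℝ :=
  fderiv ℝ φ Q ((1 : ℝ), -radialDir Q)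

/-- The derivative `∂_v φ` in the `u`-`v`-spherical coordinates: `∂_v = ∂_t + ∂_r`. -/
def partialV (φ : Spacetime n → ℝ) (Q : Spacetime n) : ℝ :=
  fderiv ℝ φ Q ((1 : ℝ), radialDir Q)

/-- The length of the spherical gradient of `φ` at `Q = (t, x)`: the norm of the orthogonal projection
of the spatial gradient to the tangent space of the sphere of constant `t` and `r`. This tangent
space is the orthogonal complement of `x`, and the induced metric `r² γ` of the sphere is the
restriction of the Euclidean inner product. -/
def sphGradNorm (φ : Spacetime n → ℝ) (Q : Spacetime n) : ℝ :=
  ‖(Submodule.span ℝ {Q.2})ᗮ.starProjection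
    (gradient (fun x : EuclideanSpace ℝ (Fin n) => φ (Q.1, x)) Q.2)‖

/-- The wave operator `□ = -∂_t² + Δ_x` of the Minkowski metric `-dt² + dr² + r² γ`. -/
def box (φ : Spacetime n → ℝ) (Q : Spacetime n) : ℝ :=
  -iteratedDeriv 2 (fun t : ℝ => φ (t, Q.2)) Q.1
    + Laplacian.laplacian (fun x : EuclideanSpace ℝ (Fin n) => φ (Q.1, x)) Q.2

/-- The weight `(1 + |u|) (1 + |v|)`. -/
def weight (Q : Spacetime n) : ℝ := (1 + |nullU Q|) * (1 + |nullV Q|)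

/-- The decay condition with parameter `δ` on `φ` and its first derivatives. -/
def DecayCondition (δ : ℝ) (φ : Spacetime n → ℝ) : Prop :=
  BddAbove ((fun Q => weight Q ^ (((n : ℝ) - 1 + δ) / 2) *
      (|nullU Q * partialU φ Q| + |nullV Q * partialV φ Q|)) '' exterior n) ∧
  BddAbove ((fun Q => weight Q ^ (((n : ℝ) - 1 + δ) / 2) *
      |nullU Q * nullV Q| ^ ((1 : ℝ) / 2) * sphGradNorm φ Q) ''
        (exterior n ∩ {Q | |nullU Q * nullV Q| < 1})) ∧
  BddAbove ((fun Q => weight Q ^ (((n : ℝ) - 1 + δ) / 2) * |φ Q|) '' exterior n)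

/-- The additional decay condition on `V ^ (1 / (p + 1)) |φ|` in the region `|uv| > 1`. -/
def FocusingDecayCondition (δ p : ℝ) (V φ : Spacetime n → ℝ) : Prop :=
  BddAbove ((fun Q => weight Q ^ (((n : ℝ) - 1 + δ) / (p + 1)) *
      |nullU Q * nullV Q| ^ (1 / (p + 1)) * V Q ^ (1 / (p + 1)) * |φ Q|) ''
        (exterior n ∩ {Q | 1 < |nullU Q * nullV Q|}))

end UniqueContinuation

end

noncomputable section

namespace UniqueContinuation

open MeasureTheory Set Filter Topology

variable {n : ℕ}

/-! The proof is an energy estimate whose multiplier is built from the dilation field S = t∂_t +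
r∂_r = u∂_u + v∂_v. On the exterior f = -uv is positive, its Minkowski gradient is S/2, and S is
conformal Killing. Multiply the equation by f^l (Sφ + bφ) with b = (n-1)/2 + l. This value of b
removes the indefinite quantity m(dφ, dφ) from the bulk, and the terms in Sφ and φ complete a
square. By `energy_identity` the bulk is (l/2) f^(l-1) (Sφ + bφ)² plus f^l |φ|^(p+1)/(p+1) times SV
+ (2l + n + 1 - b(p+1)) V. Since 2l + n + 1 - b(p+1) = ((n-1)/2)(1 + 4/(n-1) - p) - l(p-1), the
bound on S(log V) makes the last factor positive as soon as l(p-1) ≤ μ (`bulk_coefficient_pos`).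

The fluxes at the cone and at infinity are removed by a cutoff of scale k in log f and log(v/(-u)).
Its logarithmic derivatives are O(1/k), and by `flux_le` the flux is at most C/k times f^(l-1)
w^(-(n-1+δ)), where w is the weight. This is integrable exactly when 0 < l < δ: positivity of l
handles the cone, l < δ handles infinity (`integrable_majorant`). The cutoff increases with f for f
< 1 and decreases for f > 1. Hence the angular flux needs a bound only for f < 1, and the potential
flux only for f > 1, which are the regions where the hypotheses supply one.

Thus the cut-off bulk integral is at most C/k (`exists_integral_bulk_le`). The bulk is nonnegative
and the cutoffs increase with k, so the integral vanishes at every scale, which forces φ = 0. One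
fixed small l suffices; no large parameter is involved. -/

instance isAddHaarMeasure_volume_spacetime :
    (volume : Measure (Spacetime n)).IsAddHaarMeasure :=
  Measure.prod.instIsAddHaarMeasure volume volume

/-- The derivative of a `C¹` function of compact support integrates to zero. -/
theorem integrable_fderiv_and_integral_eq_zero {F : Spacetime n → ℝ} (hF : ContDiff ℝ 1 F)
    (hc : HasCompactSupport F) (v : Spacetime n) :
    Integrable (fun Q => fderiv ℝ F Q v) ∧ ∫ Q, fderiv ℝ F Q v = 0 := by
  have hi : Integrable (fun Q => fderiv ℝ F Q v) := by
    apply Continuous.integrable_of_hasCompactSupport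
    · exact (hF.continuous_fderiv (by norm_num)).clm_apply continuous_const
    · exact hc.fderiv_apply (𝕜 := ℝ) v
  refine ⟨hi, ?_⟩
  -- Integration by parts against the constant function 1.
  have h := integral_mul_fderiv_eq_neg_fderiv_mul_of_integrable (𝕜 := ℝ) (μ := (volume : Measure (Spacetime n)))
    (f := fun _ => (1 : ℝ)) (g := F) (v := v) (by simp) (by simpa using hi)
    (by simpa using hF.continuous.integrable_of_hasCompactSupport hc)
    (by intro x _; fun_prop) (by intro x _; exact (hF.differentiable (by norm_num)) x)
  simpa using h

/-! ### Integrability of the dominating function. -/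

/-- The one-dimensional profile `y ^ (l - 1) (1 + y) ^ (-d)` on the half-line. -/
def halfLineProfile (l d : ℝ) : ℝ → ℝ :=
  (Ioi 0).indicator fun y => y ^ (l - 1) * (1 + y) ^ (-d)

theorem halfLineProfile_nonneg (l d y : ℝ) : 0 ≤ halfLineProfile l d y := by
  unfold halfLineProfile
  apply indicator_nonneg
  intro y hy
  have : (0 : ℝ) < y := hy
  positivity

/-- Near 0 the profile is at most y^(l-1), integrable as l > 0; beyond 1 it is at most y^(l-1-d),
integrable as l < d. -/
theorem integrable_halfLineProfile {l d : ℝ} (hl : 0 < l) (hd : l < d) :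
    Integrable (halfLineProfile l d) := by
  unfold halfLineProfile
  rw [integrable_indicator_iff measurableSet_Ioi, ← Ioc_union_Ioi_eq_Ioi zero_le_one]
  have hm : Measurable fun y : ℝ => y ^ (l - 1) * (1 + y) ^ (-d) := by fun_prop
  refine IntegrableOn.union ?_ ?_
  · have h1 : IntegrableOn (fun y : ℝ => y ^ (l - 1)) (Ioc 0 1) :=
      (intervalIntegral.intervalIntegrable_rpow' (by linarith)).1
    refine Integrable.mono h1 hm.aestronglyMeasurable ?_
    filter_upwards [ae_restrict_mem measurableSet_Ioc] with y hy
    have hy0 : 0 < y := hy.1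
    rw [Real.norm_of_nonneg (by positivity), Real.norm_of_nonneg (by positivity)]
    have : (1 + y) ^ (-d) ≤ 1 :=
      Real.rpow_le_one_of_one_le_of_nonpos (by linarith) (by linarith)
    exact mul_le_of_le_one_right (by positivity) this
  · have h1 : IntegrableOn (fun y : ℝ => y ^ (l - 1 - d)) (Ioi 1) :=
      integrableOn_Ioi_rpow_of_lt (by linarith) one_pos
    refine Integrable.mono h1 hm.aestronglyMeasurable ?_
    filter_upwards [ae_restrict_mem measurableSet_Ioi] with y hy
    have hy0 : 0 < y := lt_trans one_pos hy
    rw [Real.norm_of_nonneg (by positivity), Real.norm_of_nonneg (by positivity),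
      sub_eq_add_neg (l - 1) d, Real.rpow_add hy0]
    gcongr ?_ * ?_
    exact Real.rpow_le_rpow_of_nonpos hy0 (by linarith) (by linarith)

/-- The null coordinate change `(t, r) ↦ ((r - t) / 2, (r + t) / 2)`. -/
def nullChange : (ℝ × ℝ) →ₗ[ℝ] (ℝ × ℝ) where
  toFun q := ((q.2 - q.1) / 2, (q.2 + q.1) / 2)
  map_add' a b := by ext <;> simp <;> ring
  map_smul' c a := by ext <;> simp <;> ring

/-- The null coordinate change is invertible. -/
def nullChangeEquiv : (ℝ × ℝ) ≃ₗ[ℝ] (ℝ × ℝ) where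
  __ := nullChange
  invFun q := (q.2 - q.1, q.2 + q.1)
  left_inv q := by ext <;> simp [nullChange] <;> ring
  right_inv q := by ext <;> simp [nullChange]

theorem integrable_comp_nullChange {G : ℝ × ℝ → ℝ} (hG : Integrable G) :
    Integrable (fun q => G (nullChange q)) := by
  have hdet : LinearMap.det nullChange ≠ 0 := by
    have := (LinearEquiv.isUnit_det' nullChangeEquiv).ne_zero
    exact this
  have hmap := Measure.map_linearMap_addHaar_eq_smul_addHaar
    (volume : Measure (ℝ × ℝ)) hdet
  have hcont : Continuous nullChange := by
    change Continuous fun q : ℝ × ℝ => ((q.2 - q.1) / 2, (q.2 + q.1) / 2)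
    fun_prop
  have h : Integrable G (Measure.map nullChange volume) := by
    rw [hmap]; exact hG.smul_measure ENNReal.ofReal_ne_top
  exact h.comp_measurable hcont.measurable

/-- The dominating function `f ^ (l - 1) w ^ (-d)` on the exterior region, where `f = -u v`
and `w` is the weight. -/
def majorant (l d : ℝ) (Q : Spacetime n) : ℝ :=
  (exterior n).indicator (fun Q => (-(nullU Q * nullV Q)) ^ (l - 1) * weight Q ^ (-d)) Q

theorem isOpen_exterior : IsOpen (exterior n) :=
  isOpen_lt (by fun_prop) (by fun_prop)

theorem nullU_neg {Q : Spacetime n} (hQ : Q ∈ exterior n) : nullU Q < 0 := by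
  have : |Q.1| < ‖Q.2‖ := hQ
  have := abs_lt.1 this
  unfold nullU; linarith

theorem nullV_pos {Q : Spacetime n} (hQ : Q ∈ exterior n) : 0 < nullV Q := by
  have : |Q.1| < ‖Q.2‖ := hQ
  have := abs_lt.1 this
  unfold nullV; linarith

theorem weight_pos (Q : Spacetime n) : 0 < weight Q := by unfold weight; positivity

theorem majorant_nonneg (l d : ℝ) (Q : Spacetime n) : 0 ≤ majorant l d Q := by
  unfold majorant
  apply indicator_nonneg
  intro Q hQ
  have h1 := nullU_neg hQ
  have h2 := nullV_pos hQ
  have h3 := weight_pos Q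
  have : 0 < -(nullU Q * nullV Q) := by nlinarith
  positivity

theorem measurable_majorant (l d : ℝ) : Measurable (majorant l d : Spacetime n → ℝ) := by
  unfold majorant
  apply Measurable.indicator _ isOpen_exterior.measurableSet
  unfold nullU nullV weight nullU nullV
  fun_prop

/-- The radial profile of the majorant. -/
def radialMajorant (l d t r : ℝ) : ℝ :=
  {q : ℝ × ℝ | |q.1| < q.2}.indicator (fun q => (-((q.1 - q.2) / 2 * ((q.1 + q.2) / 2))) ^ (l - 1) *
    ((1 + |(q.1 - q.2) / 2|) * (1 + |(q.1 + q.2) / 2|)) ^ (-d)) (t, r)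

theorem majorant_eq_radialMajorant (l d : ℝ) (Q : Spacetime n) :
    majorant l d Q = radialMajorant l d Q.1 ‖Q.2‖ := by
  unfold majorant radialMajorant indicator exterior nullU nullV weight nullU nullV
  simp only [mem_ofPred_eq]

theorem measurable_radialMajorant (l d : ℝ) :
    Measurable fun q : ℝ × ℝ => radialMajorant l d q.1 q.2 := by
  unfold radialMajorant
  apply Measurable.indicator
  · fun_prop
  · exact (isOpen_lt (by fun_prop) (by fun_prop)).measurableSet

/-- With a = -u and b = v, one has r = a + b ≤ 2(1+a)(1+b). So k powers of the weight absorb the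
polar Jacobian r^k, and what remains factors in the null coordinates. -/
theorem radialMajorant_le (k : ℕ) {l d t r : ℝ} (hr : 0 < r) :
    ‖r ^ k • radialMajorant l (k + d) t r‖ ≤
      2 ^ k * (halfLineProfile l d (nullChange (t, r)).1 * halfLineProfile l d (nullChange (t, r)).2) := by
  by_cases h : |t| < r
  · obtain ⟨h1, h2⟩ := abs_lt.1 h
    have ha : 0 < (r - t) / 2 := by linarith
    have hb : 0 < (r + t) / 2 := by linarith
    have e : (nullChange (t, r)) = ((r - t) / 2, (r + t) / 2) := rfl
    rw [e]
    unfold radialMajorant halfLineProfile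
    rw [indicator_of_mem (by exact h), indicator_of_mem (by exact ha), indicator_of_mem (by exact hb)]
    simp only
    have e1 : (t - r) / 2 = -((r - t) / 2) := by ring
    have e2 : (t + r) / 2 = (r + t) / 2 := by ring
    have e3 : r = (r - t) / 2 + (r + t) / 2 := by ring
    rw [e1, e2]
    generalize (r - t) / 2 = a at *
    generalize (r + t) / 2 = b at *
    have e4 : -(-a * b) = a * b := by ring
    have hw : 0 < (1 + a) * (1 + b) := by positivity
    rw [abs_neg, abs_of_pos ha, abs_of_pos hb, e4, Real.norm_of_nonneg (by positivity), smul_eq_mul,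
      Real.mul_rpow ha.le hb.le, neg_add, Real.rpow_add hw,
      Real.mul_rpow (z := -d) (by positivity) (by positivity), Real.rpow_neg hw.le, Real.rpow_natCast]
    have h3 : r ^ k * (((1 + a) * (1 + b)) ^ k)⁻¹ ≤ 2 ^ k := by
      rw [← div_eq_mul_inv, div_le_iff₀ (by positivity), ← mul_pow]
      gcongr
      rw [e3]; nlinarith
    calc _ = (r ^ k * (((1 + a) * (1 + b)) ^ k)⁻¹) *
          (a ^ (l - 1) * (1 + a) ^ (-d) * (b ^ (l - 1) * (1 + b) ^ (-d))) := by ring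
      _ ≤ _ := by gcongr
  · unfold radialMajorant
    rw [indicator_of_notMem (by exact h)]
    have := halfLineProfile_nonneg l d (nullChange (t, r)).1
    have := halfLineProfile_nonneg l d (nullChange (t, r)).2
    simp only [smul_zero, norm_zero]
    positivity

/-- Polar coordinates in x reduce this to two variables, where the bound splits into a product of
half-line profiles. The surplus n - 1 in the exponent pays for the volume r^(n-1) of the spheres. -/
theorem integrable_majorant (hn : 2 ≤ n) {l d : ℝ} (hl : 0 < l) (hd : l < d) :
    Integrable (majorant l ((n : ℝ) - 1 + d) : Spacetime n → ℝ) := by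
  have : NeZero n := ⟨by omega⟩
  have hk : ((n - 1 : ℕ) : ℝ) = (n : ℝ) - 1 := by rw [Nat.cast_sub (by omega)]; simp
  rw [← hk]
  set k := n - 1 with hkdef
  have hfin : Module.finrank ℝ (EuclideanSpace ℝ (Fin n)) - 1 = k := by simp [hkdef]
  have hnt : Nontrivial (EuclideanSpace ℝ (Fin n)) :=
    Module.nontrivial_of_finrank_pos (R := ℝ) (by simp; omega)
  have hH : Integrable (fun q : ℝ × ℝ => q.2 ^ k • radialMajorant l (k + d) q.1 q.2)
      ((volume : Measure ℝ).prod (volume.restrict (Ioi 0))) := by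
    have h2 := ((integrable_halfLineProfile hl hd).mul_prod (integrable_halfLineProfile hl hd))
    have h3 := (integrable_comp_nullChange h2).const_mul (2 ^ k)
    have h4 : Integrable (fun q : ℝ × ℝ => (2 : ℝ) ^ k * (halfLineProfile l d (nullChange q).1 *
        halfLineProfile l d (nullChange q).2)) ((volume : Measure ℝ).prod (volume.restrict (Ioi 0))) := by
      have e : (volume : Measure ℝ).prod (volume.restrict (Ioi 0)) =
          (volume : Measure (ℝ × ℝ)).restrict (univ ×ˢ Ioi 0) := by
        rw [Measure.volume_eq_prod, ← Measure.prod_restrict, Measure.restrict_univ]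
      rw [e]
      exact h3.integrableOn
    refine h4.mono' ?_ ?_
    · exact ((measurable_snd.pow_const k).smul (measurable_radialMajorant l _)).aestronglyMeasurable
    · have : ∀ᵐ q ∂((volume : Measure ℝ).prod (volume.restrict (Ioi (0 : ℝ)))), 0 < q.2 :=
        Measure.quasiMeasurePreserving_snd.ae (ae_restrict_mem measurableSet_Ioi)
      filter_upwards [this] with q hq
      exact radialMajorant_le k hq
  rw [integrable_prod_iff hH.1] at hH
  rw [Measure.volume_eq_prod, integrable_prod_iff (measurable_majorant l _).aestronglyMeasurable]
  simp only [majorant_eq_radialMajorant]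
  constructor
  · filter_upwards [hH.1] with t ht
    rw [integrable_fun_norm_addHaar (volume : Measure (EuclideanSpace ℝ (Fin n)))
      (f := fun r => radialMajorant l (k + d) t r), hfin]
    exact ht
  · have e : (fun t => ∫ x : EuclideanSpace ℝ (Fin n), ‖radialMajorant l (k + d) t ‖x‖‖) =
        fun t => (Module.finrank ℝ (EuclideanSpace ℝ (Fin n)) •
          (volume : Measure (EuclideanSpace ℝ (Fin n))).real (Metric.ball 0 1)) •
          ∫ r in Ioi (0 : ℝ), ‖r ^ k • radialMajorant l (k + d) t r‖ := by
      funext t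
      rw [integral_fun_norm_addHaar (volume : Measure (EuclideanSpace ℝ (Fin n)))
        (fun r => ‖radialMajorant l (k + d) t r‖), hfin, smul_assoc]
      congr 2
      refine setIntegral_congr_fun measurableSet_Ioi fun r hr => ?_
      have : (0 : ℝ) < r := hr
      simp only [smul_eq_mul, norm_mul, norm_pow, Real.norm_of_nonneg this.le]
    rw [e]
    exact Integrable.smul (_ : ℝ) hH.2

/-! ### Minkowski geometry in null coordinates. -/

/-- The coordinate vector field `∂_t`. -/
def timeVec (n : ℕ) : Spacetime n := (1, 0)

/-- The coordinate vector field `∂_{x_i}`. -/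
def spaceVec (i : Fin n) : Spacetime n := (0, EuclideanSpace.single i 1)

/-- The Minkowski inner product of two covectors. -/
def minkowski (L M : Spacetime n →L[ℝ] ℝ) : ℝ :=
  -(L (timeVec n) * M (timeVec n)) + ∑ i, L (spaceVec i) * M (spaceVec i)

theorem minkowski_add_left (L L' M : Spacetime n →L[ℝ] ℝ) :
    minkowski (L + L') M = minkowski L M + minkowski L' M := by
  simp only [minkowski, add_apply, add_mul, Finset.sum_add_distrib]
  ring

theorem minkowski_smul_left (c : ℝ) (L M : Spacetime n →L[ℝ] ℝ) :
    minkowski (c • L) M = c * minkowski L M := by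
  simp only [minkowski, smul_apply, smul_eq_mul, mul_assoc, ← Finset.mul_sum]
  ring

theorem minkowski_sub_left (L L' M : Spacetime n →L[ℝ] ℝ) :
    minkowski (L - L') M = minkowski L M - minkowski L' M := by
  simp only [minkowski, sub_apply, sub_mul, Finset.sum_sub_distrib]
  ring

theorem eq_sum_single (x : EuclideanSpace ℝ (Fin n)) :
    x = ∑ i, x i • EuclideanSpace.single i (1 : ℝ) := by
  have h := (EuclideanSpace.basisFun (Fin n) ℝ).sum_repr x
  simpa using h.symm

theorem map_eq_sum (M : Spacetime n →L[ℝ] ℝ) (c : ℝ) (x : EuclideanSpace ℝ (Fin n)) :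
    M (c, x) = c * M (timeVec n) + ∑ i, x i * M (spaceVec i) := by
  have h : ((c, x) : Spacetime n) = c • timeVec n + ∑ i, x i • spaceVec i := by
    ext1
    · simp [timeVec, spaceVec, Prod.fst_sum]
    · simp only [timeVec, spaceVec, Prod.smul_mk, smul_zero, Prod.snd_add, zero_add, Prod.snd_sum]
      exact eq_sum_single x
  rw [h, map_add, map_smul, map_sum]
  simp

/-- Pairing with a covector of the form `a dt + ⟨w, dx⟩`. -/
theorem minkowski_eq_apply {L : Spacetime n →L[ℝ] ℝ} {a : ℝ} {w : EuclideanSpace ℝ (Fin n)}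
    (h0 : L (timeVec n) = a) (hi : ∀ i, L (spaceVec i) = w i) (M : Spacetime n →L[ℝ] ℝ) :
    minkowski L M = M (-a, w) := by
  rw [map_eq_sum, minkowski, h0]
  simp [hi]

/-- The function `f = -u v = (r² - t²) / 4`. -/
def coneFun (Q : Spacetime n) : ℝ := -(nullU Q * nullV Q)

theorem coneFun_eq (Q : Spacetime n) : coneFun Q = (‖Q.2‖ ^ 2 - Q.1 ^ 2) / 4 := by
  unfold coneFun nullU nullV; ring

theorem coneFun_pos {Q : Spacetime n} (hQ : Q ∈ exterior n) : 0 < coneFun Q := by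
  have h1 := nullU_neg hQ
  have h2 := nullV_pos hQ
  unfold coneFun; nlinarith

theorem snd_ne_zero {Q : Spacetime n} (hQ : Q ∈ exterior n) : Q.2 ≠ 0 := by
  have : |Q.1| < ‖Q.2‖ := hQ
  have h := (abs_nonneg Q.1).trans_lt this
  exact norm_pos_iff.1 h

/-- The differential of `r = |x|`. -/
def dRadius (Q : Spacetime n) : Spacetime n →L[ℝ] ℝ :=
  (innerSL ℝ (radialDir Q)).comp (ContinuousLinearMap.snd ℝ ℝ (EuclideanSpace ℝ (Fin n)))

theorem hasFDerivAt_radius {Q : Spacetime n} (hQ : Q.2 ≠ 0) :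
    HasFDerivAt (fun P : Spacetime n => ‖P.2‖) (dRadius Q) Q := by
  have h1 := (hasStrictFDerivAt_norm_sq Q.2).hasFDerivAt.sqrt (by simpa using hQ)
  have h2 := h1.comp Q (hasFDerivAt_snd (𝕜 := ℝ) (E := ℝ) (F := EuclideanSpace ℝ (Fin n)) (p := Q))
  have e : (fun P : Spacetime n => ‖P.2‖) = (fun x => √(‖x‖ ^ 2)) ∘ Prod.snd := by
    funext P; simp
  rw [e]
  refine h2.congr_fderiv ?_
  ext v
  · simp [dRadius]
  · simp [dRadius, radialDir]
    field_simp

theorem inner_single (w : EuclideanSpace ℝ (Fin n)) (i : Fin n) :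
    inner ℝ w (EuclideanSpace.single i (1 : ℝ)) = w i := by
  rw [EuclideanSpace.inner_single_right]; simp

/-- The differential of `u`. -/
def dNullU (Q : Spacetime n) : Spacetime n →L[ℝ] ℝ :=
  (1 / 2 : ℝ) • (ContinuousLinearMap.fst ℝ ℝ (EuclideanSpace ℝ (Fin n)) - dRadius Q)

/-- The differential of `v`. -/
def dNullV (Q : Spacetime n) : Spacetime n →L[ℝ] ℝ :=
  (1 / 2 : ℝ) • (ContinuousLinearMap.fst ℝ ℝ (EuclideanSpace ℝ (Fin n)) + dRadius Q)

theorem hasFDerivAt_nullU {Q : Spacetime n} (hQ : Q.2 ≠ 0) :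
    HasFDerivAt nullU (dNullU Q) Q := by
  have h := ((hasFDerivAt_fst (𝕜 := ℝ) (E := ℝ) (F := EuclideanSpace ℝ (Fin n)) (p := Q)).sub
    (hasFDerivAt_radius hQ)).const_mul (1 / 2)
  refine HasFDerivAt.congr_of_eventuallyEq h (Eventually.of_forall fun P => ?_)
  simp [nullU]; ring

theorem hasFDerivAt_nullV {Q : Spacetime n} (hQ : Q.2 ≠ 0) :
    HasFDerivAt nullV (dNullV Q) Q := by
  have h := ((hasFDerivAt_fst (𝕜 := ℝ) (E := ℝ) (F := EuclideanSpace ℝ (Fin n)) (p := Q)).add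
    (hasFDerivAt_radius hQ)).const_mul (1 / 2)
  refine HasFDerivAt.congr_of_eventuallyEq h (Eventually.of_forall fun P => ?_)
  simp [nullV]; ring

theorem minkowski_dRadius (Q : Spacetime n) (M : Spacetime n →L[ℝ] ℝ) :
    minkowski (dRadius Q) M = M (0, radialDir Q) := by
  have := minkowski_eq_apply (L := dRadius Q) (a := 0) (w := radialDir Q)
    (by simp [dRadius, timeVec]) (fun i => by simp [dRadius, spaceVec, inner_single]) M
  simpa using this

theorem minkowski_fst (M : Spacetime n →L[ℝ] ℝ) :
    minkowski (ContinuousLinearMap.fst ℝ ℝ (EuclideanSpace ℝ (Fin n))) M = M (-1, 0) :=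
  minkowski_eq_apply (by simp [timeVec]) (fun i => by simp [spaceVec]) M

/-- Raising an index exchanges the two null directions: the gradient of u is -∂_v/2. -/
theorem minkowski_dNullU (Q : Spacetime n) (φ : Spacetime n → ℝ) :
    minkowski (dNullU Q) (fderiv ℝ φ Q) = -partialV φ Q / 2 := by
  rw [dNullU, minkowski_smul_left, minkowski_sub_left, minkowski_fst, minkowski_dRadius, partialV,
    ← map_sub, neg_div, ← neg_div, ← map_neg]
  simp only [Prod.mk_sub_mk, Prod.neg_mk, zero_sub, sub_zero]
  ring

theorem minkowski_dNullV (Q : Spacetime n) (φ : Spacetime n → ℝ) :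
    minkowski (dNullV Q) (fderiv ℝ φ Q) = -partialU φ Q / 2 := by
  rw [dNullV, minkowski_smul_left, minkowski_add_left, minkowski_fst, minkowski_dRadius, partialU,
    ← map_add, neg_div, ← neg_div, ← map_neg]
  simp only [Prod.mk_add_mk, Prod.neg_mk, zero_add, add_zero, neg_neg]
  ring

theorem dRadius_self (Q : Spacetime n) : dRadius Q Q = ‖Q.2‖ := by
  by_cases h : Q.2 = 0
  · simp [dRadius, h]
  · have : ‖Q.2‖ ≠ 0 := by simpa using h
    simp [dRadius, radialDir]
    field_simp

theorem dNullU_self (Q : Spacetime n) : dNullU Q Q = nullU Q := by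
  simp only [dNullU, smul_apply, sub_apply,
    dRadius_self, nullU, ContinuousLinearMap.coe_fst', smul_eq_mul]
  ring

theorem dNullV_self (Q : Spacetime n) : dNullV Q Q = nullV Q := by
  simp only [dNullV, smul_apply, add_apply,
    dRadius_self, nullV, ContinuousLinearMap.coe_fst', smul_eq_mul]
  ring

/-- The dilation derivative in null coordinates. -/
theorem fderiv_self {Q : Spacetime n} (hQ : Q.2 ≠ 0) (φ : Spacetime n → ℝ) :
    fderiv ℝ φ Q Q = nullU Q * partialU φ Q + nullV Q * partialV φ Q := by
  have hr : ‖Q.2‖ ≠ 0 := by simpa using hQ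
  have h : Q = nullU Q • ((1 : ℝ), -radialDir Q) + nullV Q • ((1 : ℝ), radialDir Q) := by
    ext1
    · simp [nullU, nullV]; ring
    · simp only [Prod.smul_mk, Prod.mk_add_mk, smul_neg, ← sub_eq_neg_add, ← sub_smul]
      have : nullV Q - nullU Q = ‖Q.2‖ := by unfold nullU nullV; ring
      rw [this, radialDir, smul_smul, mul_inv_cancel₀ hr, one_smul]
  have h' := congrArg (fderiv ℝ φ Q) h
  rw [h', map_add, map_smul, map_smul, partialU, partialV, smul_eq_mul, smul_eq_mul]

/-- The differential of `f`. -/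
def dConeFun (Q : Spacetime n) : Spacetime n →L[ℝ] ℝ :=
  -(nullU Q • dNullV Q + nullV Q • dNullU Q)

theorem hasFDerivAt_coneFun {Q : Spacetime n} (hQ : Q.2 ≠ 0) :
    HasFDerivAt coneFun (dConeFun Q) Q :=
  ((hasFDerivAt_nullU hQ).mul (hasFDerivAt_nullV hQ)).neg

/-- The gradient of f is S/2. Hence the derivative of f^l in the multiplier produces the favourable
term in (Sφ)². -/
theorem minkowski_dConeFun {Q : Spacetime n} (hQ : Q.2 ≠ 0) (φ : Spacetime n → ℝ) :
    minkowski (dConeFun Q) (fderiv ℝ φ Q) = fderiv ℝ φ Q Q / 2 := by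
  have : dConeFun Q = (-nullU Q) • dNullV Q + (-nullV Q) • dNullU Q := by
    rw [dConeFun]; module
  rw [this, minkowski_add_left, minkowski_smul_left, minkowski_smul_left, minkowski_dNullU,
    minkowski_dNullV, fderiv_self hQ]
  ring

/-- Euler's identity: f is homogeneous of degree two. -/
theorem dConeFun_self (Q : Spacetime n) : dConeFun Q Q = 2 * coneFun Q := by
  simp only [dConeFun, neg_apply, add_apply,
    smul_apply, dNullU_self, dNullV_self, smul_eq_mul, coneFun]
  ring

theorem fderiv_slice {φ : Spacetime n → ℝ} {Q : Spacetime n} (h : DifferentiableAt ℝ φ Q)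
    (y : EuclideanSpace ℝ (Fin n)) :
    fderiv ℝ (fun x => φ (Q.1, x)) Q.2 y = fderiv ℝ φ Q (0, y) := by
  have h1 : HasFDerivAt φ (fderiv ℝ φ Q) (Q.1, Q.2) := h.hasFDerivAt
  have h2 : HasFDerivAt (fun x => φ (Q.1, x)) _ Q.2 := h1.comp Q.2 (hasFDerivAt_prodMk_right Q.1 Q.2)
  rw [h2.fderiv]
  simp

theorem norm_sq_eq_sum (x : EuclideanSpace ℝ (Fin n)) : ‖x‖ ^ 2 = ∑ i, x i * x i := by
  rw [EuclideanSpace.norm_sq_eq]; simp [sq]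

/-- The Minkowski norm of the differential in null coordinates. -/
theorem minkowski_fderiv_self {φ : Spacetime n → ℝ} {Q : Spacetime n} (hQ : Q.2 ≠ 0)
    (h : DifferentiableAt ℝ φ Q) :
    minkowski (fderiv ℝ φ Q) (fderiv ℝ φ Q) = -(partialU φ Q * partialV φ Q) + sphGradNorm φ Q ^ 2 := by
  have hr : ‖Q.2‖ ≠ 0 := by simpa using hQ
  set g := gradient (fun x : EuclideanSpace ℝ (Fin n) => φ (Q.1, x)) Q.2 with hg
  have hin : ∀ y, inner ℝ g y = fderiv ℝ φ Q (0, y) := by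
    intro y
    rw [← fderiv_slice h, hg, gradient, InnerProductSpace.toDual_symm_apply]
  have hgi : ∀ i, g i = fderiv ℝ φ Q (spaceVec i) := by
    intro i; rw [← inner_single, hin]; rfl
  -- Pythagoras splits the spatial gradient into its radial part and its part tangent to the sphere.
  have hpy := (Submodule.span ℝ {Q.2}).norm_sq_eq_add_norm_sq_starProjection g
  have hs : ‖(Submodule.span ℝ {Q.2}).starProjection g‖ ^ 2 = (fderiv ℝ φ Q (0, radialDir Q)) ^ 2 := by
    rw [Submodule.starProjection_singleton, norm_smul, mul_pow, ← hin, radialDir, inner_smul_right,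
      real_inner_comm]
    simp only [RCLike.ofReal_real_eq_id, id_eq, Real.norm_eq_abs, sq_abs]
    field_simp
  have hN : minkowski (fderiv ℝ φ Q) (fderiv ℝ φ Q) = -(fderiv ℝ φ Q (timeVec n)) ^ 2 + ‖g‖ ^ 2 := by
    rw [minkowski, norm_sq_eq_sum]
    simp only [hgi]; ring
  have hU : partialU φ Q = fderiv ℝ φ Q (timeVec n) - fderiv ℝ φ Q (0, radialDir Q) := by
    rw [partialU, ← map_sub]; simp [timeVec]
  have hV : partialV φ Q = fderiv ℝ φ Q (timeVec n) + fderiv ℝ φ Q (0, radialDir Q) := by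
    rw [partialV, ← map_add]; simp [timeVec]
  rw [hN, hpy, hs, hU, hV, sphGradNorm]
  ring

/-- The wave operator as a contraction of the second derivative. -/
theorem box_eq {φ : Spacetime n → ℝ} {Q : Spacetime n} (h : ContDiffAt ℝ 2 φ Q) :
    box φ Q = -(fderiv ℝ (fderiv ℝ φ) Q (timeVec n) (timeVec n)) +
      ∑ i, fderiv ℝ (fderiv ℝ φ) Q (spaceVec i) (spaceVec i) := by
  have hd : HasFDerivAt (fderiv ℝ φ) (fderiv ℝ (fderiv ℝ φ) Q) Q :=
    ((h.fderiv_right (m := 1) (by norm_num)).differentiableAt (by norm_num)).hasFDerivAt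
  have hev : ∀ᶠ P in 𝓝 Q, DifferentiableAt ℝ φ P :=
    (h.eventually (by simp)).mono fun P hP => hP.differentiableAt (by norm_num)
  unfold box
  congr 1
  · congr 1
    rw [iteratedDeriv_succ, iteratedDeriv_one]
    have hc : ContinuousAt (fun t : ℝ => ((t, Q.2) : Spacetime n)) Q.1 := by fun_prop
    have h1 : deriv (fun t : ℝ => φ (t, Q.2)) =ᶠ[𝓝 Q.1]
        fun t => fderiv ℝ φ (t, Q.2) (timeVec n) := by
      filter_upwards [hc.eventually hev] with t ht
      have h2 : HasDerivAt (fun s : ℝ => ((s, Q.2) : Spacetime n)) (timeVec n) t :=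
        (hasDerivAt_id t).prodMk (hasDerivAt_const t Q.2)
      exact (ht.hasFDerivAt.comp_hasDerivAt t h2).deriv
    rw [h1.deriv_eq]
    have h2 : HasDerivAt (fun s : ℝ => ((s, Q.2) : Spacetime n)) (timeVec n) Q.1 :=
      (hasDerivAt_id Q.1).prodMk (hasDerivAt_const Q.1 Q.2)
    have h3 : HasDerivAt (fun s : ℝ => fderiv ℝ φ (s, Q.2)) (fderiv ℝ (fderiv ℝ φ) Q (timeVec n)) Q.1 :=
      HasFDerivAt.comp_hasDerivAt (x := Q.1) (f := fun s : ℝ => ((s, Q.2) : Spacetime n)) hd h2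
    exact (h3.clm_apply (hasDerivAt_const Q.1 (timeVec n))).deriv.trans (by simp)
  · rw [InnerProductSpace.laplacian_eq_iteratedFDeriv_orthonormalBasis _ (EuclideanSpace.basisFun (Fin n) ℝ)]
    refine Finset.sum_congr rfl fun i _ => ?_
    rw [iteratedFDeriv_two_apply]
    simp only [Matrix.cons_val_zero, Matrix.cons_val_one, EuclideanSpace.basisFun_apply]
    have hc : ContinuousAt (fun x : EuclideanSpace ℝ (Fin n) => ((Q.1, x) : Spacetime n)) Q.2 := by fun_prop
    have h1 : fderiv ℝ (fun x => φ (Q.1, x)) =ᶠ[𝓝 Q.2]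
        fun x => (fderiv ℝ φ (Q.1, x)).comp (ContinuousLinearMap.inr ℝ ℝ (EuclideanSpace ℝ (Fin n))) := by
      filter_upwards [hc.eventually hev] with x hx
      ext y
      rw [fderiv_slice (Q := (Q.1, x)) hx]
      simp
    rw [h1.fderiv_eq]
    have h3 : HasFDerivAt (fun x : EuclideanSpace ℝ (Fin n) => fderiv ℝ φ (Q.1, x))
        ((fderiv ℝ (fderiv ℝ φ) Q).comp (ContinuousLinearMap.inr ℝ ℝ (EuclideanSpace ℝ (Fin n)))) Q.2 :=
      HasFDerivAt.comp Q.2 hd (hasFDerivAt_prodMk_right Q.1 Q.2)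
    rw [(h3.clm_comp (hasFDerivAt_const _ Q.2)).fderiv]
    simp [spaceVec]

/-! ### The energy identity for the dilation multiplier. -/

/-- The derivative along the dilation field `S = t ∂_t + r ∂_r`. -/
def dilation (φ : Spacetime n → ℝ) (Q : Spacetime n) : ℝ := fderiv ℝ φ Q Q

/-- The Minkowski norm `m(dφ, dφ)`. -/
def gradSq (φ : Spacetime n → ℝ) (Q : Spacetime n) : ℝ := minkowski (fderiv ℝ φ Q) (fderiv ℝ φ Q)

/-- The value of S at a point is the point itself, so differentiating the argument contributes an
extra dφ. With the symmetry of second derivatives this gives m(d(Sφ), dφ) = m(dφ, dφ) + S(m(dφ,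
dφ))/2. -/
theorem hasFDerivAt_dilation {φ : Spacetime n → ℝ} {Q : Spacetime n}
    (hd : HasFDerivAt (fderiv ℝ φ) (fderiv ℝ (fderiv ℝ φ) Q) Q) :
    HasFDerivAt (dilation φ) (fderiv ℝ φ Q + (fderiv ℝ (fderiv ℝ φ) Q).flip Q) Q := by
  have h := hd.clm_apply (hasFDerivAt_id Q)
  refine HasFDerivAt.congr_fderiv (f := dilation φ) h ?_
  rw [ContinuousLinearMap.comp_id]; rfl

theorem hasFDerivAt_minkowski {G : Spacetime n → (Spacetime n →L[ℝ] ℝ)}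
    {G' : Spacetime n →L[ℝ] Spacetime n →L[ℝ] ℝ} {Q : Spacetime n} (h : HasFDerivAt G G' Q) :
    ∃ L : Spacetime n →L[ℝ] ℝ, HasFDerivAt (fun P => minkowski (G P) (G P)) L Q ∧
      ∀ v, L v = 2 * minkowski (G' v) (G Q) := by
  have h1 : ∀ e : Spacetime n, HasFDerivAt (fun P => G P e) (G'.flip e) Q := by
    intro e
    simpa using h.clm_apply (hasFDerivAt_const e Q)
  refine ⟨_, (((h1 (timeVec n)).mul (h1 (timeVec n))).neg).add
    (HasFDerivAt.fun_sum fun i _ => (h1 (spaceVec i)).mul (h1 (spaceVec i))), fun v => ?_⟩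
  simp only [minkowski, add_apply, neg_apply, smul_apply,
    ContinuousLinearMap.flip_apply, smul_eq_mul, sum_apply, mul_add,
    Finset.mul_sum]
  congr 1
  · ring
  · exact Finset.sum_congr rfl fun i _ => by ring

/-- The divergence of the vector field `A ∇φ`. -/
def waveDivergence (A φ : Spacetime n → ℝ) (Q : Spacetime n) : ℝ :=
  -(fderiv ℝ (fun P => A P * fderiv ℝ φ P (timeVec n)) Q (timeVec n)) +
    ∑ i, fderiv ℝ (fun P => A P * fderiv ℝ φ P (spaceVec i)) Q (spaceVec i)

/-- The divergence of the vector field `B S`, where `S` is the dilation field. -/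
def dilationDivergence (B : Spacetime n → ℝ) (Q : Spacetime n) : ℝ :=
  fderiv ℝ (fun P => P.1 * B P) Q (timeVec n) +
    ∑ i, fderiv ℝ (fun P => P.2 i * B P) Q (spaceVec i)

theorem waveDivergence_eq {A φ : Spacetime n → ℝ} {Q : Spacetime n} {A' : Spacetime n →L[ℝ] ℝ}
    (hA : HasFDerivAt A A' Q) (hφ : ContDiffAt ℝ 2 φ Q) :
    waveDivergence A φ Q = minkowski A' (fderiv ℝ φ Q) + A Q * box φ Q := by
  have hd : HasFDerivAt (fderiv ℝ φ) (fderiv ℝ (fderiv ℝ φ) Q) Q :=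
    ((hφ.fderiv_right (m := 1) (by norm_num)).differentiableAt (by norm_num)).hasFDerivAt
  have h1 : ∀ e : Spacetime n, fderiv ℝ (fun P => A P * fderiv ℝ φ P e) Q e =
      A' e * fderiv ℝ φ Q e + A Q * fderiv ℝ (fderiv ℝ φ) Q e e := by
    intro e
    have h2 : HasFDerivAt (fun P => fderiv ℝ φ P e) ((fderiv ℝ (fderiv ℝ φ) Q).flip e) Q := by
      simpa using hd.clm_apply (hasFDerivAt_const e Q)
    rw [(hA.fun_mul h2).fderiv]
    simp; ring
  rw [waveDivergence, box_eq hφ, minkowski]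
  simp only [h1, Finset.sum_add_distrib, mul_add, Finset.mul_sum]
  ring

/-- The divergence of S in 1 + n dimensions is n + 1. -/
theorem dilationDivergence_eq {B : Spacetime n → ℝ} {Q : Spacetime n} {B' : Spacetime n →L[ℝ] ℝ}
    (hB : HasFDerivAt B B' Q) :
    dilationDivergence B Q = B' Q + ((n : ℝ) + 1) * B Q := by
  have h0 : fderiv ℝ (fun P : Spacetime n => P.1 * B P) Q (timeVec n) = Q.1 * B' (timeVec n) + B Q := by
    rw [((hasFDerivAt_fst (𝕜 := ℝ) (p := Q)).fun_mul hB).fderiv]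
    simp [timeVec]
  have hi : ∀ i, fderiv ℝ (fun P : Spacetime n => P.2 i * B P) Q (spaceVec i) =
      Q.2 i * B' (spaceVec i) + B Q := by
    intro i
    have h2 : HasFDerivAt (fun P : Spacetime n => P.2 i)
        ((EuclideanSpace.proj i).comp
          (ContinuousLinearMap.snd ℝ ℝ (EuclideanSpace ℝ (Fin n)))) Q :=
      ((EuclideanSpace.proj (𝕜 := ℝ) i).comp
          (ContinuousLinearMap.snd ℝ ℝ (EuclideanSpace ℝ (Fin n)))).hasFDerivAt
    rw [(h2.fun_mul hB).fderiv]
    simp [spaceVec]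
  have hQ := map_eq_sum B' Q.1 Q.2
  rw [Prod.mk.eta] at hQ
  rw [dilationDivergence, h0, hQ]
  simp only [hi, Finset.sum_add_distrib, Finset.sum_const, Finset.card_univ, Fintype.card_fin,
    nsmul_eq_mul]
  ring

/-- The multiplier `f ^ l (S φ + b φ)`. -/
def multiplier (l b : ℝ) (φ : Spacetime n → ℝ) (Q : Spacetime n) : ℝ :=
  coneFun Q ^ l * (dilation φ Q + b * φ Q)

/-- The potential `½ f ^ l m(dφ, dφ) - ¼ l b f ^ (l - 1) φ² - f ^ l V |φ| ^ (p + 1) / (p + 1)`. -/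
def energyPotential (l b p : ℝ) (V φ : Spacetime n → ℝ) (Q : Spacetime n) : ℝ :=
  coneFun Q ^ l * (gradSq φ Q / 2) - (l * b / 4) * (coneFun Q ^ (l - 1) * (φ Q * φ Q)) -
    coneFun Q ^ l * (V Q * (|φ Q| ^ (p + 1) / (p + 1)))

/-- The bulk density of the energy identity. -/
def bulk (l b p : ℝ) (V φ : Spacetime n → ℝ) (Q : Spacetime n) : ℝ :=
  (l / 2) * (coneFun Q ^ (l - 1) * (dilation φ Q + b * φ Q) ^ 2) +
    coneFun Q ^ l * (|φ Q| ^ (p + 1) / (p + 1)) *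
      (dilation V Q + (2 * l + n + 1 - b * (p + 1)) * V Q)

theorem hasFDerivAt_coneFun_rpow {Q : Spacetime n} (hQ : Q ∈ exterior n) (l : ℝ) :
    HasFDerivAt (fun P => coneFun P ^ l) ((l * coneFun Q ^ (l - 1)) • dConeFun Q) Q :=
  (hasFDerivAt_coneFun (snd_ne_zero hQ)).rpow_const (Or.inl (coneFun_pos hQ).ne')

/-- The energy identity, pointwise form. -/
theorem energy_identity {l b p : ℝ} {V φ η : Spacetime n → ℝ} {Q : Spacetime n}
    {η' : Spacetime n →L[ℝ] ℝ} (hQ : Q ∈ exterior n) (hb : b = ((n : ℝ) - 1) / 2 + l) (hp : 1 ≤ p)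
    (hφ : ContDiffAt ℝ 2 φ Q) (hV : DifferentiableAt ℝ V Q) (hη : HasFDerivAt η η' Q)
    (heq : box φ Q + V Q * |φ Q| ^ (p - 1) * φ Q = 0) :
    waveDivergence (fun P => η P * multiplier l b φ P) φ Q -
        dilationDivergence (fun P => η P * energyPotential l b p V φ P) Q =
      η Q * bulk l b p V φ Q + multiplier l b φ Q * minkowski η' (fderiv ℝ φ Q) -
        energyPotential l b p V φ Q * η' Q := by
  have hQ2 := snd_ne_zero hQ
  have hf := coneFun_pos hQ
  have hd : HasFDerivAt (fderiv ℝ φ) (fderiv ℝ (fderiv ℝ φ) Q) Q :=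
    ((hφ.fderiv_right (m := 1) (by norm_num)).differentiableAt (by norm_num)).hasFDerivAt
  have hsymm : IsSymmSndFDerivAt ℝ φ Q := hφ.isSymmSndFDerivAt (by simp)
  have hflip : (fderiv ℝ (fderiv ℝ φ) Q).flip Q = fderiv ℝ (fderiv ℝ φ) Q Q := by
    exact ContinuousLinearMap.ext fun v => hsymm v Q
  have hφ1 : HasFDerivAt φ (fderiv ℝ φ Q) Q := (hφ.differentiableAt (by norm_num)).hasFDerivAt
  obtain ⟨N', hN, hN'⟩ := hasFDerivAt_minkowski hd
  have hdil := hasFDerivAt_dilation hd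
  rw [hflip] at hdil
  have hfl := hasFDerivAt_coneFun_rpow hQ l
  have hfl1 := hasFDerivAt_coneFun_rpow hQ (l - 1)
  have hM := hη.fun_mul (hfl.fun_mul (hdil.fun_add (hφ1.const_mul b)))
  have hW := waveDivergence_eq hM hφ
  have habs : HasFDerivAt (fun P => |φ P| ^ (p + 1)) _ Q :=
    (hasDerivAt_abs_rpow (φ Q) (p := p + 1) (by linarith)).comp_hasFDerivAt Q hφ1
  have hB := hη.fun_mul (((hfl.fun_mul (hN.mul_const (1 / 2))).fun_sub
    ((hfl1.fun_mul (hφ1.fun_mul hφ1)).const_mul (l * b / 4))).fun_sub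
    (hfl.fun_mul (hV.hasFDerivAt.fun_mul (habs.mul_const (1 / (p + 1))))))
  have hB2 := hB.congr_of_eventuallyEq (f₁ := fun P => η P * energyPotential l b p V φ P)
    (Eventually.of_forall fun P => by simp only [energyPotential, gradSq, div_eq_mul_inv, one_mul])
  have hD := dilationDivergence_eq hB2
  have hbox : box φ Q = -(V Q * |φ Q| ^ (p - 1) * φ Q) := by linarith
  rw [show (fun P => η P * multiplier l b φ P) = fun P => η P *
    (coneFun P ^ l * (dilation φ P + b * φ P)) from rfl, hW, hD, hbox]
  have e1 : coneFun Q ^ l = coneFun Q ^ (l - 1) * coneFun Q := by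
    rw [← Real.rpow_add_one hf.ne']; ring_nf
  have e2 : coneFun Q ^ (l - 1) = coneFun Q ^ (l - 1 - 1) * coneFun Q := by
    rw [← Real.rpow_add_one hf.ne']; ring_nf
  have e3 : |φ Q| ^ (p + 1) = |φ Q| ^ (p - 1) * φ Q * φ Q := by
    have : p + 1 = (p - 1) + (2 : ℕ) := by push_cast; ring
    rw [this, Real.rpow_add_natCast' (abs_nonneg _) (by push_cast; linarith), sq_abs]
    ring
  have e4 : p + 1 - 2 = p - 1 := by ring
  have hp0 : p + 1 ≠ 0 := by linarith
  simp only [minkowski_add_left, minkowski_smul_left, minkowski_dConeFun hQ2, hN', dConeFun_self,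
    add_apply, smul_apply, sub_apply, smul_eq_mul, e4, e3,
    multiplier, energyPotential, bulk, dilation, gradSq]
  -- All powers of f are reduced to f^(l-2). The coefficient of m(dφ, dφ) is then b - l - (n-1)/2 =
  -- 0, and 2l + n - 1 = 2b makes the square exact.
  rw [e1, e2, hb]
  field_simp
  ring

/-! ### The logarithmic cutoff. -/

theorem hasDerivAt_posPart_sq (z : ℝ) : HasDerivAt (fun y : ℝ => max 0 y ^ 2) (2 * max 0 z) z := by
  rcases lt_trichotomy z 0 with h | rfl | h
  · rw [max_eq_left h.le, mul_zero]
    refine (hasDerivAt_const z (0 : ℝ)).congr_of_eventuallyEq ?_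
    filter_upwards [Iio_mem_nhds h] with y hy
    have : y < 0 := hy
    simp [max_eq_left this.le]
  · rw [max_self, mul_zero, hasDerivAt_iff_isLittleO]
    have h1 : (fun y : ℝ => y ^ 2) =o[𝓝 0] fun y => y := Asymptotics.isLittleO_pow_id (by norm_num)
    have h2 : (fun y : ℝ => max 0 y ^ 2) =O[𝓝 0] fun y : ℝ => y ^ 2 := by
      refine Asymptotics.IsBigO.of_bound 1 (Eventually.of_forall fun y => ?_)
      rw [Real.norm_of_nonneg (by positivity), Real.norm_of_nonneg (by positivity), one_mul, sq_le_sq]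
      rcases le_total 0 y with h | h
      · rw [max_eq_right h]
      · rw [max_eq_left h]; simp
    simpa using h2.trans_isLittleO h1
  · rw [max_eq_right h.le]
    have h1 : HasDerivAt (fun y : ℝ => y ^ 2) (2 * z) z := by simpa using hasDerivAt_pow 2 z
    refine h1.congr_of_eventuallyEq ?_
    filter_upwards [Ioi_mem_nhds h] with y hy
    have : 0 < y := hy
    simp [max_eq_right this.le]

/-- The even `C¹` bump profile `((1 - y²)₊)²`. -/
def bump (y : ℝ) : ℝ := max 0 (1 - y ^ 2) ^ 2

/-- The derivative of the bump profile. -/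
def bumpDeriv (y : ℝ) : ℝ := -4 * y * max 0 (1 - y ^ 2)

theorem hasDerivAt_bump (y : ℝ) : HasDerivAt bump (bumpDeriv y) y := by
  have h1 : HasDerivAt (fun y : ℝ => 1 - y ^ 2) (-(2 * y)) y := by
    simpa using (hasDerivAt_pow 2 y).const_sub 1
  refine ((hasDerivAt_posPart_sq (1 - y ^ 2)).comp y h1).congr_deriv ?_
  unfold bumpDeriv; ring

/-- One derivative is enough, because the energy identity differentiates the cutoff only once. -/
theorem contDiff_bump : ContDiff ℝ 1 bump := by
  rw [contDiff_one_iff_deriv]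
  refine ⟨fun y => (hasDerivAt_bump y).differentiableAt, ?_⟩
  have : deriv bump = bumpDeriv := funext fun y => (hasDerivAt_bump y).deriv
  rw [this]
  unfold bumpDeriv
  fun_prop

theorem bump_nonneg (y : ℝ) : 0 ≤ bump y := by unfold bump; positivity

theorem bump_le_one (y : ℝ) : bump y ≤ 1 := by
  unfold bump
  have h0 : 0 ≤ max 0 (1 - y ^ 2) := le_max_left _ _
  have h1 : max 0 (1 - y ^ 2) ≤ 1 := max_le zero_le_one (by nlinarith [sq_nonneg y])
  exact pow_le_one₀ h0 h1

theorem bump_pos {y : ℝ} (hy : |y| < 1) : 0 < bump y := by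
  have : 0 < 1 - y ^ 2 := by rw [← sq_abs]; nlinarith [abs_nonneg y]
  unfold bump
  rw [max_eq_right this.le]
  positivity

theorem abs_lt_one_of_bump_ne_zero {y : ℝ} (hy : bump y ≠ 0) : |y| < 1 := by
  by_contra h
  push Not at h
  apply hy
  have : 1 - y ^ 2 ≤ 0 := by rw [← sq_abs]; nlinarith
  simp [bump, max_eq_left this]

theorem bump_anti {y z : ℝ} (h : |y| ≤ |z|) : bump z ≤ bump y := by
  have h2 : y ^ 2 ≤ z ^ 2 := sq_le_sq.2 h
  unfold bump
  gcongr

theorem abs_bumpDeriv_le (y : ℝ) : |bumpDeriv y| ≤ 4 := by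
  unfold bumpDeriv
  by_cases h : |y| < 1
  · have h0 : 0 ≤ max 0 (1 - y ^ 2) := le_max_left _ _
    have h1 : max 0 (1 - y ^ 2) ≤ 1 := max_le zero_le_one (by nlinarith [sq_nonneg y])
    rw [abs_mul, abs_mul, abs_of_nonneg h0]
    norm_num
    nlinarith [abs_nonneg y]
  · push Not at h
    have : 1 - y ^ 2 ≤ 0 := by rw [← sq_abs]; nlinarith
    simp [max_eq_left this]

/-- This sign and the opposite one for y ≥ 0 let the angular and potential fluxes be discarded on
one side of f = 1 each. -/
theorem bumpDeriv_nonneg {y : ℝ} (hy : y ≤ 0) : 0 ≤ bumpDeriv y := by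
  unfold bumpDeriv
  have h0 : 0 ≤ max 0 (1 - y ^ 2) := le_max_left _ _
  exact mul_nonneg (by linarith) h0

theorem bumpDeriv_nonpos {y : ℝ} (hy : 0 ≤ y) : bumpDeriv y ≤ 0 := by
  unfold bumpDeriv
  have h0 : 0 ≤ max 0 (1 - y ^ 2) := le_max_left _ _
  exact mul_nonpos_of_nonpos_of_nonneg (by linarith) h0

/-- The logarithm of `v / (-u)`, a function constant along the dilation flow. -/
def rapidity (Q : Spacetime n) : ℝ := Real.log (nullV Q) - Real.log (nullU Q)

/-- The cutoff of scale `k` in the variables `log f` and `log (v / (-u))`. -/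
def cutoff (k : ℝ) : Spacetime n → ℝ :=
  (exterior n).indicator fun Q => bump (Real.log (coneFun Q) / k) * bump (rapidity Q / k)

theorem cutoff_of_mem {k : ℝ} {Q : Spacetime n} (hQ : Q ∈ exterior n) :
    cutoff k Q = bump (Real.log (coneFun Q) / k) * bump (rapidity Q / k) :=
  indicator_of_mem hQ _

theorem cutoff_nonneg (k : ℝ) (Q : Spacetime n) : 0 ≤ cutoff k Q :=
  indicator_nonneg (fun _ _ => mul_nonneg (bump_nonneg _) (bump_nonneg _)) Q

/-- A larger scale moves both arguments towards the peak of the even bump. Monotonicity transfers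
the decay C/m at large scales to a fixed scale. -/
theorem cutoff_mono {k m : ℝ} (hk : 0 < k) (hkm : k ≤ m) (Q : Spacetime n) :
    cutoff k Q ≤ cutoff m Q := by
  refine indicator_le_indicator' fun _ => ?_
  have h : ∀ y : ℝ, bump (y / k) ≤ bump (y / m) := by
    intro y
    apply bump_anti
    rw [abs_div, abs_div, abs_of_pos hk, abs_of_pos (hk.trans_le hkm)]
    gcongr
  exact mul_le_mul (h _) (h _) (bump_nonneg _) (bump_nonneg _)

theorem exists_cutoff_pos {Q : Spacetime n} (hQ : Q ∈ exterior n) : ∃ k, 0 < k ∧ 0 < cutoff k Q := by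
  refine ⟨|Real.log (coneFun Q)| + |rapidity Q| + 1, by positivity, ?_⟩
  rw [cutoff_of_mem hQ]
  have h : ∀ y : ℝ, |y| ≤ |Real.log (coneFun Q)| + |rapidity Q| →
      0 < bump (y / (|Real.log (coneFun Q)| + |rapidity Q| + 1)) := by
    intro y hy
    apply bump_pos
    have hp : 0 < |Real.log (coneFun Q)| + |rapidity Q| + 1 := by positivity
    rw [abs_div, abs_of_pos hp, div_lt_one hp]
    linarith
  exact mul_pos (h _ (by linarith [abs_nonneg (rapidity Q)]))
    (h _ (by linarith [abs_nonneg (Real.log (coneFun Q))]))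

theorem continuous_coneFun : Continuous (coneFun : Spacetime n → ℝ) := by
  unfold coneFun nullU nullV; fun_prop

theorem mem_exterior_of_coneFun_pos {Q : Spacetime n} (h : 0 < coneFun Q) : Q ∈ exterior n := by
  rw [coneFun_eq] at h
  have : |Q.1| < |‖Q.2‖| := sq_lt_sq.1 (by linarith)
  rwa [abs_norm] at this

/-- A compact subset of the exterior region that supports the cutoff. -/
def cutoffRegion (n : ℕ) (k : ℝ) : Set (Spacetime n) :=
  Metric.closedBall 0 (2 * Real.exp k) ∩ {Q | Real.exp (-k) ≤ coneFun Q}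

theorem isCompact_cutoffRegion (k : ℝ) : IsCompact (cutoffRegion n k) :=
  (isCompact_closedBall _ _).inter_right (isClosed_le continuous_const continuous_coneFun)

theorem cutoffRegion_subset (k : ℝ) : cutoffRegion n k ⊆ exterior n := fun _ hQ =>
  mem_exterior_of_coneFun_pos ((Real.exp_pos _).trans_le hQ.2)

theorem tsupport_cutoff_subset {k : ℝ} (hk : 0 < k) :
    tsupport (cutoff k : Spacetime n → ℝ) ⊆ cutoffRegion n k := by
  refine closure_minimal ?_ (isCompact_cutoffRegion k).isClosed
  intro Q hQ
  have hQD : Q ∈ exterior n := by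
    by_contra h
    exact hQ (indicator_of_notMem h _)
  rw [Function.mem_support, cutoff_of_mem hQD] at hQ
  have h1 := abs_lt_one_of_bump_ne_zero (left_ne_zero_of_mul hQ)
  have h2 := abs_lt_one_of_bump_ne_zero (right_ne_zero_of_mul hQ)
  rw [abs_div, abs_of_pos hk, div_lt_one hk, abs_lt] at h1 h2
  have hu := nullU_neg hQD
  have hv := nullV_pos hQD
  have hf := coneFun_pos hQD
  -- `Real.log` ignores signs, so log u stands for log(-u). Sum and difference of log v and log(-u)
  -- are both less than k in absolute value, hence each logarithm is below k.
  have hs : Real.log (coneFun Q) = Real.log (nullU Q) + Real.log (nullV Q) := by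
    rw [coneFun, Real.log_neg_eq_log, Real.log_mul hu.ne hv.ne']
  unfold rapidity at h2
  have hv' : nullV Q < Real.exp k := (Real.log_lt_iff_lt_exp hv).1 (by linarith)
  have hu' : -nullU Q < Real.exp k := by
    rw [← Real.log_lt_iff_lt_exp (by linarith), Real.log_neg_eq_log]; linarith
  have hr : ‖Q.2‖ ≤ 2 * Real.exp k := by
    have : ‖Q.2‖ = nullV Q - nullU Q := by unfold nullU nullV; ring
    linarith
  have ht : |Q.1| < ‖Q.2‖ := hQD
  constructor
  · rw [mem_closedBall_zero_iff, Prod.norm_def]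
    exact max_le (by rw [Real.norm_eq_abs]; linarith) hr
  · change Real.exp (-k) ≤ coneFun Q
    rw [← Real.le_log_iff_exp_le hf]; linarith

theorem contDiffOn_radius : ContDiffOn ℝ 1 (fun Q : Spacetime n => ‖Q.2‖) (exterior n) :=
  ContDiffOn.norm ℝ contDiffOn_snd fun _ hQ => snd_ne_zero hQ

theorem contDiffOn_nullU : ContDiffOn ℝ 1 (nullU : Spacetime n → ℝ) (exterior n) :=
  (contDiffOn_fst.sub contDiffOn_radius).div_const 2

theorem contDiffOn_nullV : ContDiffOn ℝ 1 (nullV : Spacetime n → ℝ) (exterior n) :=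
  (contDiffOn_fst.add contDiffOn_radius).div_const 2

theorem contDiffOn_coneFun : ContDiffOn ℝ 1 (coneFun : Spacetime n → ℝ) (exterior n) :=
  (contDiffOn_nullU.mul contDiffOn_nullV).neg

theorem contDiffOn_coneFun_rpow (l : ℝ) :
    ContDiffOn ℝ 1 (fun Q : Spacetime n => coneFun Q ^ l) (exterior n) :=
  contDiffOn_coneFun.rpow_const_of_ne fun _ hQ => (coneFun_pos hQ).ne'

theorem contDiffOn_cutoff (k : ℝ) : ContDiffOn ℝ 1 (cutoff k : Spacetime n → ℝ) (exterior n) := by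
  have h1 : ContDiffOn ℝ 1 (fun Q : Spacetime n => Real.log (coneFun Q)) (exterior n) :=
    contDiffOn_coneFun.log fun _ hQ => (coneFun_pos hQ).ne'
  have h2 : ContDiffOn ℝ 1 (rapidity : Spacetime n → ℝ) (exterior n) :=
    (contDiffOn_nullV.log fun _ hQ => (nullV_pos hQ).ne').sub
      (contDiffOn_nullU.log fun _ hQ => (nullU_neg hQ).ne)
  have h3 := (contDiff_bump.comp_contDiffOn (h1.div_const k)).mul
    (contDiff_bump.comp_contDiffOn (h2.div_const k))
  exact h3.congr fun Q hQ => cutoff_of_mem hQ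

/-- The closed support of the cutoff is contained in the open exterior, so the product extends by
zero across the cone whatever the factor does there. -/
theorem contDiff_cutoff_mul {k : ℝ} (hk : 0 < k) {G : Spacetime n → ℝ}
    (hG : ContDiffOn ℝ 1 G (exterior n)) :
    ContDiff ℝ 1 (fun Q => cutoff k Q * G Q) := by
  rw [contDiff_iff_contDiffAt]
  intro Q
  by_cases hQ : Q ∈ tsupport (cutoff k)
  · have hQD := cutoffRegion_subset k (tsupport_cutoff_subset hk hQ)
    exact (((contDiffOn_cutoff k).mul hG).contDiffAt (isOpen_exterior.mem_nhds hQD))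
  · have h0 : (fun Q => cutoff k Q * G Q) =ᶠ[𝓝 Q] fun _ => 0 := by
      filter_upwards [notMem_tsupport_iff_eventuallyEq.1 hQ] with P hP
      rw [hP]; simp
    exact contDiffAt_const.congr_of_eventuallyEq h0

theorem continuous_cutoff_mul {k : ℝ} (hk : 0 < k) {G : Spacetime n → ℝ}
    (hG : ContinuousOn G (exterior n)) :
    Continuous (fun Q => cutoff k Q * G Q) := by
  rw [continuous_iff_continuousAt]
  intro Q
  by_cases hQ : Q ∈ tsupport (cutoff k)
  · have hQD := cutoffRegion_subset k (tsupport_cutoff_subset hk hQ)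
    exact (((contDiffOn_cutoff k).continuousOn.mul hG).continuousAt (isOpen_exterior.mem_nhds hQD))
  · have h0 : (fun Q => cutoff k Q * G Q) =ᶠ[𝓝 Q] fun _ => 0 := by
      filter_upwards [notMem_tsupport_iff_eventuallyEq.1 hQ] with P hP
      rw [hP]; simp
    exact continuousAt_const.congr h0.symm

theorem hasCompactSupport_cutoff {k : ℝ} (hk : 0 < k) :
    HasCompactSupport (cutoff k : Spacetime n → ℝ) :=
  HasCompactSupport.of_support_subset_isCompact (isCompact_cutoffRegion k)
    (subset_closure.trans (tsupport_cutoff_subset hk))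

/-- The differential of the cutoff. -/
def dCutoff (k : ℝ) (Q : Spacetime n) : Spacetime n →L[ℝ] ℝ :=
  (bumpDeriv (Real.log (coneFun Q) / k) * bump (rapidity Q / k) / k) •
      ((coneFun Q)⁻¹ • dConeFun Q) +
    (bump (Real.log (coneFun Q) / k) * bumpDeriv (rapidity Q / k) / k) •
      ((nullV Q)⁻¹ • dNullV Q - (nullU Q)⁻¹ • dNullU Q)

theorem hasFDerivAt_cutoff (k : ℝ) {Q : Spacetime n} (hQ : Q ∈ exterior n) :
    HasFDerivAt (cutoff k) (dCutoff k Q) Q := by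
  have h0 := snd_ne_zero hQ
  have h1 := ((hasFDerivAt_coneFun h0).log (coneFun_pos hQ).ne').mul_const k⁻¹
  have h2 := (((hasFDerivAt_nullV h0).log (nullV_pos hQ).ne').fun_sub
    ((hasFDerivAt_nullU h0).log (nullU_neg hQ).ne)).mul_const k⁻¹
  have h3 := (((hasDerivAt_bump _).comp_hasFDerivAt Q h1).fun_mul
    ((hasDerivAt_bump _).comp_hasFDerivAt Q h2))
  have h4 := h3.congr_of_eventuallyEq (f₁ := cutoff k)
    (by filter_upwards [isOpen_exterior.mem_nhds hQ] with P hP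
        rw [cutoff_of_mem hP]; rfl)
  refine h4.congr_fderiv ?_
  simp only [dCutoff, rapidity, div_eq_mul_inv, Function.comp_apply]
  module

/-- The rapidity is homogeneous of degree zero, so only the factor in log f varies along S. The
energy potential therefore never meets the rapidity cutoff. -/
theorem dCutoff_self {k : ℝ} {Q : Spacetime n} (hQ : Q ∈ exterior n) :
    dCutoff k Q Q = 2 * (bumpDeriv (Real.log (coneFun Q) / k) * bump (rapidity Q / k) / k) := by
  have hf := (coneFun_pos hQ).ne'
  have hu := (nullU_neg hQ).ne
  have hv := (nullV_pos hQ).ne'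
  simp only [dCutoff, add_apply, smul_apply, sub_apply, smul_eq_mul,
    dConeFun_self, dNullU_self, dNullV_self, inv_mul_cancel₀ hu, inv_mul_cancel₀ hv, sub_self]
  field_simp
  ring

/-- The gradients of log f and of the rapidity are multiples of S and of u∂_u - v∂_v, so no angular
derivative appears here. -/
theorem minkowski_dCutoff {k : ℝ} {Q : Spacetime n} (hQ : Q ∈ exterior n) (φ : Spacetime n → ℝ) :
    coneFun Q * minkowski (dCutoff k Q) (fderiv ℝ φ Q) =
      (bumpDeriv (Real.log (coneFun Q) / k) * bump (rapidity Q / k) / k) * (dilation φ Q / 2) +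
      (bump (Real.log (coneFun Q) / k) * bumpDeriv (rapidity Q / k) / k) *
        ((nullU Q * partialU φ Q - nullV Q * partialV φ Q) / 2) := by
  have hf := (coneFun_pos hQ).ne'
  have hu := (nullU_neg hQ).ne
  have hv := (nullV_pos hQ).ne'
  simp only [dCutoff, minkowski_add_left, minkowski_smul_left, minkowski_sub_left,
    minkowski_dConeFun (snd_ne_zero hQ), minkowski_dNullU, minkowski_dNullV, dilation]
  rw [mul_add]
  congr 1
  · field_simp
  · unfold coneFun; field_simp; ring

/-! ### Regularity and vanishing integrals of the cut-off divergences. -/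

theorem contDiffOn_fderiv_apply {φ : Spacetime n → ℝ} (hφ : ContDiffOn ℝ 2 φ (exterior n))
    (e : Spacetime n) : ContDiffOn ℝ 1 (fun Q => fderiv ℝ φ Q e) (exterior n) :=
  (hφ.fderiv_of_isOpen isOpen_exterior (by norm_num)).clm_apply contDiffOn_const

theorem contDiffOn_dilation {φ : Spacetime n → ℝ} (hφ : ContDiffOn ℝ 2 φ (exterior n)) :
    ContDiffOn ℝ 1 (dilation φ) (exterior n) :=
  (hφ.fderiv_of_isOpen isOpen_exterior (by norm_num)).clm_apply contDiffOn_id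

theorem continuousOn_dilation {V : Spacetime n → ℝ} (hV : ContDiffOn ℝ 1 V (exterior n)) :
    ContinuousOn (dilation V) (exterior n) :=
  (hV.continuousOn_fderiv_of_isOpen isOpen_exterior (by norm_num)).clm_apply continuousOn_id

theorem contDiffOn_gradSq {φ : Spacetime n → ℝ} (hφ : ContDiffOn ℝ 2 φ (exterior n)) :
    ContDiffOn ℝ 1 (gradSq φ) (exterior n) := by
  have h := contDiffOn_fderiv_apply hφ
  exact (((h (timeVec n)).mul (h (timeVec n))).neg).add
    (ContDiffOn.sum fun i _ => (h (spaceVec i)).mul (h (spaceVec i)))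

theorem contDiffOn_multiplier (l b : ℝ) {φ : Spacetime n → ℝ}
    (hφ : ContDiffOn ℝ 2 φ (exterior n)) : ContDiffOn ℝ 1 (multiplier l b φ) (exterior n) :=
  (contDiffOn_coneFun_rpow l).mul
    ((contDiffOn_dilation hφ).add (contDiffOn_const.mul (hφ.of_le (by norm_num))))

theorem contDiffOn_abs_rpow {p : ℝ} (hp : 1 ≤ p) {φ : Spacetime n → ℝ}
    (hφ : ContDiffOn ℝ 1 φ (exterior n)) :
    ContDiffOn ℝ 1 (fun Q => |φ Q| ^ (p + 1)) (exterior n) :=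
  (contDiff_norm_rpow (E := ℝ) (p := p + 1) (by linarith)).comp_contDiffOn hφ

theorem contDiffOn_energyPotential (l b : ℝ) {p : ℝ} (hp : 1 ≤ p) {V φ : Spacetime n → ℝ}
    (hφ : ContDiffOn ℝ 2 φ (exterior n)) (hV : ContDiffOn ℝ 1 V (exterior n)) :
    ContDiffOn ℝ 1 (energyPotential l b p V φ) (exterior n) := by
  have hφ1 : ContDiffOn ℝ 1 φ (exterior n) := hφ.of_le (by norm_num)
  exact (((contDiffOn_coneFun_rpow l).mul ((contDiffOn_gradSq hφ).div_const 2)).sub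
    (contDiffOn_const.mul ((contDiffOn_coneFun_rpow (l - 1)).mul (hφ1.mul hφ1)))).sub
    ((contDiffOn_coneFun_rpow l).mul (hV.mul ((contDiffOn_abs_rpow hp hφ1).div_const (p + 1))))

theorem continuousOn_bulk (l b : ℝ) {p : ℝ} (hp : 1 ≤ p) {V φ : Spacetime n → ℝ}
    (hφ : ContDiffOn ℝ 2 φ (exterior n)) (hV : ContDiffOn ℝ 1 V (exterior n)) :
    ContinuousOn (bulk l b p V φ) (exterior n) := by
  have hφ1 : ContDiffOn ℝ 1 φ (exterior n) := hφ.of_le (by norm_num)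
  have h1 := (contDiffOn_coneFun_rpow (n := n) l).continuousOn
  have h2 := (contDiffOn_coneFun_rpow (n := n) (l - 1)).continuousOn
  have h3 := (contDiffOn_dilation hφ).continuousOn
  have h4 := continuousOn_dilation hV
  have h5 := (contDiffOn_abs_rpow hp hφ1).continuousOn
  have h6 := hφ1.continuousOn
  have h7 := hV.continuousOn
  unfold bulk
  fun_prop

/-- The divergence of a compactly supported multiple of `∇φ` integrates to zero. -/
theorem integral_waveDivergence {k : ℝ} (hk : 0 < k) {G φ : Spacetime n → ℝ}
    (hG : ContDiffOn ℝ 1 G (exterior n)) (hφ : ContDiffOn ℝ 2 φ (exterior n)) :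
    Integrable (waveDivergence (fun P => cutoff k P * G P) φ) ∧
      ∫ Q, waveDivergence (fun P => cutoff k P * G P) φ Q = 0 := by
  have h : ∀ e : Spacetime n,
      Integrable (fun Q => fderiv ℝ (fun P => cutoff k P * G P * fderiv ℝ φ P e) Q e) ∧
      ∫ Q, fderiv ℝ (fun P => cutoff k P * G P * fderiv ℝ φ P e) Q e = 0 := by
    intro e
    simp only [mul_assoc]
    exact integrable_fderiv_and_integral_eq_zero
      (contDiff_cutoff_mul hk (hG.mul (contDiffOn_fderiv_apply hφ e)))
      (hasCompactSupport_cutoff hk).mul_right e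
  have hs : Integrable fun Q => ∑ i, fderiv ℝ (fun P => cutoff k P * G P * fderiv ℝ φ P (spaceVec i)) Q
      (spaceVec i) := integrable_finsetSum _ fun i _ => (h (spaceVec i)).1
  refine ⟨(h (timeVec n)).1.neg.add hs, ?_⟩
  unfold waveDivergence
  refine (integral_add (h (timeVec n)).1.neg hs).trans ?_
  rw [integral_finsetSum _ fun i _ => (h (spaceVec i)).1]
  simp [integral_neg, h]

/-- The divergence of a compactly supported multiple of the dilation field integrates to zero. -/
theorem integral_dilationDivergence {k : ℝ} (hk : 0 < k) {G : Spacetime n → ℝ}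
    (hG : ContDiffOn ℝ 1 G (exterior n)) :
    Integrable (dilationDivergence (fun P => cutoff k P * G P)) ∧
      ∫ Q, dilationDivergence (fun P => cutoff k P * G P) Q = 0 := by
  have h : ∀ (X : Spacetime n → ℝ) (_ : ContDiff ℝ 1 X) (e : Spacetime n),
      Integrable (fun Q => fderiv ℝ (fun P => X P * (cutoff k P * G P)) Q e) ∧
      ∫ Q, fderiv ℝ (fun P => X P * (cutoff k P * G P)) Q e = 0 := by
    intro X hX e
    simp only [mul_left_comm (X _)]
    exact integrable_fderiv_and_integral_eq_zero
      (contDiff_cutoff_mul hk (hX.contDiffOn.mul hG)) (hasCompactSupport_cutoff hk).mul_right e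
  have h0 := h (fun P => P.1) contDiff_fst (timeVec n)
  have hi : ∀ i, _ := fun i : Fin n => h (fun P => P.2 i)
    (((EuclideanSpace.proj (𝕜 := ℝ) i).comp
      (ContinuousLinearMap.snd ℝ ℝ (EuclideanSpace ℝ (Fin n)))).contDiff) (spaceVec i)
  have hs : Integrable fun Q => ∑ i, fderiv ℝ (fun P : Spacetime n => P.2 i * (cutoff k P * G P)) Q
      (spaceVec i) := integrable_finsetSum _ fun i _ => (hi i).1
  refine ⟨h0.1.add hs, ?_⟩
  unfold dilationDivergence
  rw [integral_add h0.1 hs, h0.2, integral_finsetSum _ fun i _ => (hi i).1]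
  simp [hi]

theorem fderiv_eq_zero_of_notMem_tsupport {k : ℝ} {F : Spacetime n → ℝ} {Q : Spacetime n}
    (hQ : Q ∉ tsupport (cutoff k)) (hF : ∀ P, cutoff k P = 0 → F P = 0) : fderiv ℝ F Q = 0 := by
  have h0 : F =ᶠ[𝓝 Q] fun _ => 0 := by
    filter_upwards [notMem_tsupport_iff_eventuallyEq.1 hQ] with P hP
    exact hF P hP
  rw [h0.fderiv_eq]; simp

theorem waveDivergence_eq_zero {k : ℝ} {G φ : Spacetime n → ℝ} {Q : Spacetime n}
    (hQ : Q ∉ tsupport (cutoff k)) : waveDivergence (fun P => cutoff k P * G P) φ Q = 0 := by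
  unfold waveDivergence
  rw [fderiv_eq_zero_of_notMem_tsupport hQ (by intro P hP; simp [hP]), Finset.sum_eq_zero]
  · simp
  · intro i _
    rw [fderiv_eq_zero_of_notMem_tsupport hQ (by intro P hP; simp [hP])]; simp

theorem dilationDivergence_eq_zero {k : ℝ} {G : Spacetime n → ℝ} {Q : Spacetime n}
    (hQ : Q ∉ tsupport (cutoff k)) : dilationDivergence (fun P => cutoff k P * G P) Q = 0 := by
  unfold dilationDivergence
  rw [fderiv_eq_zero_of_notMem_tsupport hQ (by intro P hP; simp [hP]), Finset.sum_eq_zero]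
  · simp
  · intro i _
    rw [fderiv_eq_zero_of_notMem_tsupport hQ (by intro P hP; simp [hP])]; simp

/-! ### Bounds on the boundary flux. -/

theorem sq_le_mul_rpow_neg {w e X M : ℝ} (hw : 0 < w) (hX : 0 ≤ X) (h : w ^ (e / 2) * X ≤ M) :
    X ^ 2 ≤ M ^ 2 * w ^ (-e) := by
  have h1 : (w ^ (e / 2) * X) ^ 2 ≤ M ^ 2 := pow_le_pow_left₀ (by positivity) h 2
  have h2 : (w ^ (e / 2)) ^ 2 = w ^ e := by
    rw [← Real.rpow_mul_natCast hw.le]; norm_num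
  rw [mul_pow, h2] at h1
  rw [Real.rpow_neg hw.le, ← div_eq_mul_inv, le_div_iff₀ (by positivity)]
  linarith

/-- The pointwise bounds on `φ` that the decay conditions provide. -/
theorem exists_pointwise_bounds {δ p : ℝ} (hp : 1 ≤ p) {V φ : Spacetime n → ℝ}
    (hdecay : DecayCondition δ φ) (hdecay' : FocusingDecayCondition δ p V φ)
    (hVpos : ∀ Q ∈ exterior n, 0 < V Q) :
    ∃ M : ℝ, 0 ≤ M ∧ ∀ Q ∈ exterior n,
      (|nullU Q * partialU φ Q| + |nullV Q * partialV φ Q|) ^ 2 ≤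
        M * weight Q ^ (-((n : ℝ) - 1 + δ)) ∧
      (coneFun Q < 1 → coneFun Q * sphGradNorm φ Q ^ 2 ≤ M * weight Q ^ (-((n : ℝ) - 1 + δ))) ∧
      φ Q ^ 2 ≤ M * weight Q ^ (-((n : ℝ) - 1 + δ)) ∧
      (1 < coneFun Q →
        coneFun Q * (V Q * |φ Q| ^ (p + 1)) ≤ M * weight Q ^ (-((n : ℝ) - 1 + δ))) := by
  obtain ⟨⟨M1, h1⟩, ⟨M2, h2⟩, ⟨M3, h3⟩⟩ := hdecay
  obtain ⟨M4, h4⟩ := hdecay'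
  -- A single constant for all four bounds. The absolute value is there because the real power needs
  -- a nonnegative base.
  refine ⟨M1 ^ 2 + M2 ^ 2 + M3 ^ 2 + |M4| ^ (p + 1), by positivity, fun Q hQ => ?_⟩
  have hw := weight_pos Q
  have hf := coneFun_pos hQ
  have habs : |nullU Q * nullV Q| = coneFun Q := by
    rw [← abs_neg]; exact abs_of_pos hf
  have hE : 0 ≤ weight Q ^ (-((n : ℝ) - 1 + δ)) := by positivity
  have hM4 : 0 ≤ |M4| ^ (p + 1) := by positivity
  refine ⟨?_, fun hf1 => ?_, ?_, fun hf1 => ?_⟩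
  · refine (sq_le_mul_rpow_neg hw (by positivity) (h1 ⟨Q, hQ, rfl⟩)).trans ?_
    gcongr
    nlinarith [sq_nonneg M2, sq_nonneg M3]
  · have h := h2 ⟨Q, ⟨hQ, by change |nullU Q * nullV Q| < 1; rwa [habs]⟩, rfl⟩
    simp only [mul_assoc, habs] at h
    have h' := sq_le_mul_rpow_neg hw (by unfold sphGradNorm; positivity) h
    rw [mul_pow, ← Real.sqrt_eq_rpow, Real.sq_sqrt hf.le] at h'
    refine h'.trans ?_
    gcongr
    nlinarith [sq_nonneg M1, sq_nonneg M3]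
  · rw [← sq_abs]
    refine (sq_le_mul_rpow_neg hw (by positivity) (h3 ⟨Q, hQ, rfl⟩)).trans ?_
    gcongr
    nlinarith [sq_nonneg M1, sq_nonneg M2]
  · have h := h4 ⟨Q, ⟨hQ, by change 1 < |nullU Q * nullV Q|; rwa [habs]⟩, rfl⟩
    have hV := hVpos Q hQ
    have hp1 : 0 < p + 1 := by linarith
    simp only [habs] at h
    -- Raising to the power p + 1 clears the exponents 1/(p+1).
    have h' := Real.rpow_le_rpow (by positivity) (h.trans (le_abs_self M4)) hp1.le
    rw [Real.mul_rpow (by positivity) (by positivity), Real.mul_rpow (by positivity) (by positivity),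
      Real.mul_rpow (by positivity) (by positivity), ← Real.rpow_mul hw.le, ← Real.rpow_mul hf.le,
      ← Real.rpow_mul hV.le, div_mul_cancel₀ _ hp1.ne', div_mul_cancel₀ _ hp1.ne', Real.rpow_one,
      Real.rpow_one] at h'
    rw [Real.rpow_neg hw.le, ← div_eq_mul_inv, le_div_iff₀ (by positivity)]
    nlinarith [sq_nonneg M1, sq_nonneg M2, sq_nonneg M3]

/-- The elementary estimate behind the bound on the boundary flux. -/
theorem flux_estimate {a c ε m U W b l y s q : ℝ} (ha : |a| ≤ ε) (hc : |c| ≤ ε) (hl : 0 ≤ l)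
    (hUW : (|U| + |W|) ^ 2 ≤ m) (hy : y ^ 2 ≤ m) (hs : a * s ≤ ε * m) (hq : -(a * q) ≤ ε * m) :
    -((U + W + b * y) * (a * ((U + W) / 2) + c * ((U - W) / 2))) + a * (U * W + s) -
      a * (l * b / 2 * y ^ 2) - 2 * (a * q) ≤ ε * ((6 + b ^ 2 + l * |b|) * m) := by
  have hm : 0 ≤ m := (sq_nonneg _).trans hy
  have hε : 0 ≤ ε := (abs_nonneg a).trans ha
  have hp : (U + W) ^ 2 ≤ m := by
    refine le_trans ?_ hUW
    rw [← sq_abs]; gcongr; exact abs_add_le U W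
  have hn : (U - W) ^ 2 ≤ m := by
    refine le_trans ?_ hUW
    rw [← sq_abs]; gcongr; exact abs_sub U W
  have key : ∀ {x X B : ℝ}, |x| ≤ ε → |X| ≤ B → x * X ≤ ε * B := fun {x X B} hx hX =>
    (le_abs_self _).trans (by rw [abs_mul]; exact mul_le_mul hx hX (abs_nonneg _) hε)
  have hz : (U + W + b * y) ^ 2 ≤ 2 * (1 + b ^ 2) * m := by
    nlinarith [sq_nonneg (U + W - b * y), mul_le_mul_of_nonneg_left hy (sq_nonneg b)]
  have t1 : |-((U + W + b * y) * ((U + W) / 2))| ≤ (3 / 4 + b ^ 2 / 2) * m := by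
    rw [abs_le]; constructor <;>
    nlinarith [sq_nonneg ((U + W + b * y) - (U + W)), sq_nonneg ((U + W + b * y) + (U + W))]
  have t2 : |-((U + W + b * y) * ((U - W) / 2))| ≤ (3 / 4 + b ^ 2 / 2) * m := by
    rw [abs_le]; constructor <;>
    nlinarith [sq_nonneg ((U + W + b * y) - (U - W)), sq_nonneg ((U + W + b * y) + (U - W))]
  have t3 : |U * W| ≤ m := by
    rw [abs_mul]; nlinarith [sq_nonneg (|U|), sq_nonneg (|W|), abs_nonneg U, abs_nonneg W,
      mul_nonneg (abs_nonneg U) (abs_nonneg W)]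
  have t4 : |-(l * b / 2 * y ^ 2)| ≤ l * |b| * m := by
    rw [abs_neg, abs_mul, abs_div, abs_mul, abs_of_nonneg hl, abs_of_nonneg (sq_nonneg y)]
    have : (0 : ℝ) ≤ l * |b| := by positivity
    norm_num
    nlinarith [mul_le_mul_of_nonneg_left hy this, mul_nonneg this (sq_nonneg y)]
  -- The first two bounds give 3/2 + b², the next two 1 and l|b|, and the two hypotheses on s and q
  -- give 1 and 2: in total 11/2 + b² + l|b|.
  have k1 := key ha t1
  have k2 := key hc t2
  have k3 := key ha t3
  have k4 := key ha t4
  have : 0 ≤ ε * m := mul_nonneg hε hm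
  nlinarith

/-- The bound on the boundary flux by the integrable majorant. -/
theorem flux_le {δ p l b M k : ℝ} (hp : 1 ≤ p) (hl : 0 ≤ l) (hk : 0 < k) {V φ : Spacetime n → ℝ}
    {Q : Spacetime n} (hQ : Q ∈ exterior n) (hV : 0 < V Q) (hM : 0 ≤ M)
    (hφ : DifferentiableAt ℝ φ Q)
    (h1 : (|nullU Q * partialU φ Q| + |nullV Q * partialV φ Q|) ^ 2 ≤
        M * weight Q ^ (-((n : ℝ) - 1 + δ)))
    (h2 : coneFun Q < 1 → coneFun Q * sphGradNorm φ Q ^ 2 ≤ M * weight Q ^ (-((n : ℝ) - 1 + δ)))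
    (h3 : φ Q ^ 2 ≤ M * weight Q ^ (-((n : ℝ) - 1 + δ)))
    (h4 : 1 < coneFun Q →
        coneFun Q * (V Q * |φ Q| ^ (p + 1)) ≤ M * weight Q ^ (-((n : ℝ) - 1 + δ))) :
    -(multiplier l b φ Q * minkowski (dCutoff k Q) (fderiv ℝ φ Q) -
        energyPotential l b p V φ Q * dCutoff k Q Q) ≤
      (4 * (6 + b ^ 2 + l * |b|) * M) / k * majorant l ((n : ℝ) - 1 + δ) Q := by
  have hf := coneFun_pos hQ
  have hw := weight_pos Q
  have hp1 : 0 < p + 1 := by linarith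
  have hQ2 := snd_ne_zero hQ
  set a := bumpDeriv (Real.log (coneFun Q) / k) * bump (rapidity Q / k) / k with ha_def
  set c := bump (Real.log (coneFun Q) / k) * bumpDeriv (rapidity Q / k) / k with hc_def
  set m := M * weight Q ^ (-((n : ℝ) - 1 + δ)) with hm_def
  have hm : 0 ≤ m := by positivity
  have hbabs : ∀ y : ℝ, |bump y| ≤ 1 := fun y => by
    rw [abs_of_nonneg (bump_nonneg y)]; exact bump_le_one y
  have ha : |a| ≤ 4 / k := by
    rw [ha_def, abs_div, abs_of_pos hk, abs_mul]
    gcongr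
    nlinarith [abs_bumpDeriv_le (Real.log (coneFun Q) / k), hbabs (rapidity Q / k),
      abs_nonneg (bumpDeriv (Real.log (coneFun Q) / k)), abs_nonneg (bump (rapidity Q / k))]
  have hc : |c| ≤ 4 / k := by
    rw [hc_def, abs_div, abs_of_pos hk, abs_mul]
    gcongr
    nlinarith [abs_bumpDeriv_le (rapidity Q / k), hbabs (Real.log (coneFun Q) / k),
      abs_nonneg (bumpDeriv (rapidity Q / k)), abs_nonneg (bump (Real.log (coneFun Q) / k))]
  have ha_neg : 1 ≤ coneFun Q → a ≤ 0 := fun h => by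
    have : bumpDeriv (Real.log (coneFun Q) / k) ≤ 0 :=
      bumpDeriv_nonpos (div_nonneg (Real.log_nonneg h) hk.le)
    exact div_nonpos_of_nonpos_of_nonneg (mul_nonpos_of_nonpos_of_nonneg this (bump_nonneg _)) hk.le
  have ha_pos : coneFun Q ≤ 1 → 0 ≤ a := fun h => by
    have : 0 ≤ bumpDeriv (Real.log (coneFun Q) / k) :=
      bumpDeriv_nonneg (div_nonpos_of_nonpos_of_nonneg (Real.log_nonpos hf.le h) hk.le)
    exact div_nonneg (mul_nonneg this (bump_nonneg _)) hk.le
  -- For f < 1 the angular decay applies; for f ≥ 1 the cutoff is nonincreasing in f and the term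
  -- has a good sign.
  have hs : a * (coneFun Q * sphGradNorm φ Q ^ 2) ≤ 4 / k * m := by
    have h0 : 0 ≤ coneFun Q * sphGradNorm φ Q ^ 2 := by positivity
    rcases lt_or_ge (coneFun Q) 1 with h | h
    · exact mul_le_mul ((le_abs_self a).trans ha) (h2 h) h0 (by positivity)
    · exact (mul_nonpos_of_nonpos_of_nonneg (ha_neg h) h0).trans (by positivity)
  -- The opposite dichotomy: good sign for f ≤ 1, the decay of V^(1/(p+1)) |φ| for f > 1. Positivity
  -- of V enters here.
  have hq : -(a * (coneFun Q * (V Q * (|φ Q| ^ (p + 1) / (p + 1))))) ≤ 4 / k * m := by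
    have h0 : 0 ≤ coneFun Q * (V Q * (|φ Q| ^ (p + 1) / (p + 1))) := by positivity
    rcases le_or_gt (coneFun Q) 1 with h | h
    · exact (neg_nonpos.2 (mul_nonneg (ha_pos h) h0)).trans (by positivity)
    · have h5 : coneFun Q * (V Q * (|φ Q| ^ (p + 1) / (p + 1))) ≤ m := by
        refine le_trans ?_ (h4 h)
        gcongr
        exact div_le_self (by positivity) (by linarith)
      rw [← neg_mul]
      exact mul_le_mul ((neg_le_abs a).trans ha) h5 h0 (by positivity)
  have hest := flux_estimate (b := b) ha hc hl h1 h3 hs hq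
  have hmaj : majorant l ((n : ℝ) - 1 + δ) Q = coneFun Q ^ (l - 1) * weight Q ^ (-((n : ℝ) - 1 + δ)) :=
    indicator_of_mem hQ _
  have e1 : coneFun Q ^ l = coneFun Q ^ (l - 1) * coneFun Q := by
    rw [← Real.rpow_add_one hf.ne']; ring_nf
  have hmk := minkowski_dCutoff (k := k) hQ φ
  rw [← ha_def, ← hc_def] at hmk
  have hdil : dilation φ Q = nullU Q * partialU φ Q + nullV Q * partialV φ Q := fderiv_self hQ2 φ
  have hN : coneFun Q * gradSq φ Q = nullU Q * partialU φ Q * (nullV Q * partialV φ Q) +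
      coneFun Q * sphGradNorm φ Q ^ 2 := by
    rw [gradSq, minkowski_fderiv_self hQ2 hφ, coneFun]; ring
  have hself : dCutoff k Q Q = 2 * a := dCutoff_self hQ
  rw [hdil] at hmk
  have hcalc : -(multiplier l b φ Q * minkowski (dCutoff k Q) (fderiv ℝ φ Q) -
        energyPotential l b p V φ Q * dCutoff k Q Q) = coneFun Q ^ (l - 1) *
      (-((nullU Q * partialU φ Q + nullV Q * partialV φ Q + b * φ Q) *
          (coneFun Q * minkowski (dCutoff k Q) (fderiv ℝ φ Q))) + a * (coneFun Q * gradSq φ Q) -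
        a * (l * b / 2 * φ Q ^ 2) -
        2 * (a * (coneFun Q * (V Q * (|φ Q| ^ (p + 1) / (p + 1)))))) := by
    rw [multiplier, energyPotential, hself, e1, hdil]
    ring
  rw [hcalc, hmk, hN, hmaj]
  calc _ ≤ coneFun Q ^ (l - 1) * (4 / k * ((6 + b ^ 2 + l * |b|) * m)) := by gcongr
    _ = _ := by rw [hm_def]; ring

/-! ### Positivity of the bulk and the integrated estimate. -/

/-- Positivity of the coefficient of the nonlinear bulk term. -/
theorem bulk_coefficient_pos (hn : 2 ≤ n) {p l b μ : ℝ} {V : Spacetime n → ℝ} {Q : Spacetime n}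
    (hQ : Q ∈ exterior n) (hb : b = ((n : ℝ) - 1) / 2 + l) (hl : l * (p - 1) ≤ μ)
    (hV : DifferentiableAt ℝ V Q) (hVpos : 0 < V Q)
    (hmono : nullU Q * partialU (fun P => Real.log (V P)) Q
        + nullV Q * partialV (fun P => Real.log (V P)) Q
      > -(((n : ℝ) - 1) / 2) * (1 + 4 / ((n : ℝ) - 1) - p) + μ) :
    0 < dilation V Q + (2 * l + n + 1 - b * (p + 1)) * V Q := by
  rw [← fderiv_self (snd_ne_zero hQ), (hV.hasFDerivAt.log hVpos.ne').fderiv] at hmono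
  simp only [smul_apply, smul_eq_mul] at hmono
  have hn1 : (n : ℝ) - 1 ≠ 0 := by
    have : (2 : ℝ) ≤ n := by exact_mod_cast hn
    linarith
  have e : -(((n : ℝ) - 1) / 2) * (1 + 4 / ((n : ℝ) - 1) - p) + μ =
      -(2 * l + n + 1 - b * (p + 1)) + (μ - l * (p - 1)) := by
    rw [hb]; field_simp; ring
  rw [e] at hmono
  have h : -(2 * l + n + 1 - b * (p + 1)) < (V Q)⁻¹ * fderiv ℝ V Q Q := by linarith
  rw [inv_mul_eq_div, lt_div_iff₀ hVpos] at h
  unfold dilation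
  linarith

/-- The integrated energy estimate: the cut-off bulk term is `O(1 / k)`. -/
theorem exists_integral_bulk_le (hn : 2 ≤ n) {φ V : Spacetime n → ℝ} {p δ l b : ℝ}
    (hφ : ContDiffOn ℝ 2 φ (exterior n)) (hp : 1 ≤ p) (hV : ContDiffOn ℝ 1 V (exterior n))
    (heq : ∀ Q ∈ exterior n, box φ Q + V Q * |φ Q| ^ (p - 1) * φ Q = 0)
    (hdecay : DecayCondition δ φ) (hdecay' : FocusingDecayCondition δ p V φ)
    (hVpos : ∀ Q ∈ exterior n, 0 < V Q) (hl : 0 < l) (hlδ : l < δ)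
    (hb : b = ((n : ℝ) - 1) / 2 + l) :
    ∃ C : ℝ, ∀ k, 0 < k → ∫ Q, cutoff k Q * bulk l b p V φ Q ≤ C / k := by
  obtain ⟨M, hM, hbound⟩ := exists_pointwise_bounds hp hdecay hdecay' hVpos
  refine ⟨4 * (6 + b ^ 2 + l * |b|) * M *
    ∫ Q, majorant l ((n : ℝ) - 1 + δ) (Q : Spacetime n), fun k hk => ?_⟩
  have hmaj : Integrable (majorant l ((n : ℝ) - 1 + δ) : Spacetime n → ℝ) :=
    integrable_majorant hn hl hlδ
  have hW := integral_waveDivergence hk (contDiffOn_multiplier l b hφ) hφ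
  have hD := integral_dilationDivergence hk (contDiffOn_energyPotential l b hp hφ hV)
  have hint : Integrable fun Q => cutoff k Q * bulk l b p V φ Q :=
    (continuous_cutoff_mul hk (continuousOn_bulk l b hp hφ hV)).integrable_of_hasCompactSupport
      (hasCompactSupport_cutoff hk).mul_right
  have hC : 0 ≤ 4 * (6 + b ^ 2 + l * |b|) * M / k := by positivity
  -- The two divergences stay in the pointwise bound because each of them integrates to zero. Off
  -- the exterior every term but the nonnegative majorant vanishes.
  have hpt : ∀ Q, cutoff k Q * bulk l b p V φ Q ≤
      4 * (6 + b ^ 2 + l * |b|) * M / k * majorant l ((n : ℝ) - 1 + δ) Q +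
      (waveDivergence (fun P => cutoff k P * multiplier l b φ P) φ Q -
        dilationDivergence (fun P => cutoff k P * energyPotential l b p V φ P) Q) := by
    intro Q
    by_cases hQ : Q ∈ exterior n
    · have hnhds := isOpen_exterior.mem_nhds hQ
      have hφQ := hφ.contDiffAt hnhds
      have hVQ := (hV.contDiffAt hnhds).differentiableAt (by norm_num)
      rw [energy_identity hQ hb hp hφQ hVQ (hasFDerivAt_cutoff k hQ) (heq Q hQ)]
      obtain ⟨h1, h2, h3, h4⟩ := hbound Q hQ
      have := flux_le (b := b) hp hl.le hk hQ (hVpos Q hQ) hM (hφQ.differentiableAt (by norm_num))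
        h1 h2 h3 h4
      linarith
    · have hsupp : Q ∉ tsupport (cutoff k) := fun h =>
        hQ (cutoffRegion_subset k (tsupport_cutoff_subset hk h))
      rw [waveDivergence_eq_zero hsupp, dilationDivergence_eq_zero hsupp,
        image_eq_zero_of_notMem_tsupport hsupp]
      have := mul_nonneg hC (majorant_nonneg l ((n : ℝ) - 1 + δ) Q)
      linarith
  calc ∫ Q, cutoff k Q * bulk l b p V φ Q ≤ _ :=
        integral_mono hint ((hmaj.const_mul _).add (hW.1.sub hD.1)) hpt
    _ = _ := by
        refine (integral_add (hmaj.const_mul _) (hW.1.sub hD.1)).trans ?_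
        rw [integral_sub' hW.1 hD.1, hW.2, hD.2, integral_const_mul]
        ring

end UniqueContinuation
end

/-! ### Conclusion as the cutoff scale tends to infinity. -/

theorem theorem1p6 (n : ℕ) (hn : 2 ≤ n)
    (φ V : UniqueContinuation.Spacetime n → ℝ) (p δ μ : ℝ)
    (hφ : ContDiffOn ℝ 2 φ (UniqueContinuation.exterior n))
    (hp : 1 ≤ p) (hp' : p < 1 + 4 / ((n : ℝ) - 1))
    (hV : ContDiffOn ℝ 1 V (UniqueContinuation.exterior n))
    (hVbdd : ∃ M : ℝ, ∀ Q ∈ UniqueContinuation.exterior n, |V Q| ≤ M)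
    (heq : ∀ Q ∈ UniqueContinuation.exterior n,
      UniqueContinuation.box φ Q + V Q * |φ Q| ^ (p - 1) * φ Q = 0)
    (hδ : 0 < δ)
    (hdecay : UniqueContinuation.DecayCondition δ φ)
    (hdecay' : UniqueContinuation.FocusingDecayCondition δ p V φ)
    (hμ : 0 < μ)
    (hVpos : ∀ Q ∈ UniqueContinuation.exterior n, 0 < V Q)
    (hVmono : ∀ Q ∈ UniqueContinuation.exterior n,
      UniqueContinuation.nullU Q * UniqueContinuation.partialU (fun P => Real.log (V P)) Q
        + UniqueContinuation.nullV Q * UniqueContinuation.partialV (fun P => Real.log (V P)) Q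
      > -(((n : ℝ) - 1) / 2) * (1 + 4 / ((n : ℝ) - 1) - p) + μ) :
    ∀ Q ∈ UniqueContinuation.exterior n, φ Q = 0 := by
  open UniqueContinuation in
  obtain ⟨l, hl, hlδ, hlμ⟩ : ∃ l : ℝ, 0 < l ∧ l < δ ∧ l * (p - 1) ≤ μ := by
    -- δ/2 secures l < δ, and μ/p secures l(p-1) ≤ μ; dividing by p instead of p - 1 covers p = 1.
    refine ⟨min (δ / 2) (μ / p), by positivity, (min_le_left _ _).trans_lt (by linarith), ?_⟩
    calc min (δ / 2) (μ / p) * (p - 1) ≤ μ / p * (p - 1) :=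
          mul_le_mul_of_nonneg_right (min_le_right _ _) (by linarith)
      _ ≤ μ / p * p := by gcongr; linarith
      _ = μ := div_mul_cancel₀ _ (by linarith)
  obtain ⟨b, hb⟩ : ∃ b : ℝ, b = ((n : ℝ) - 1) / 2 + l := ⟨_, rfl⟩
  obtain ⟨C, hC⟩ := exists_integral_bulk_le hn hφ hp hV heq hdecay hdecay' hVpos hl hlδ hb
  have hp1 : 0 < p + 1 := by linarith
  have hcoef : ∀ P ∈ exterior n, 0 < dilation V P + (2 * l + n + 1 - b * (p + 1)) * V P :=
    fun P hP => bulk_coefficient_pos hn hP hb hlμ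
      ((hV.contDiffAt (isOpen_exterior.mem_nhds hP)).differentiableAt (by norm_num)) (hVpos P hP)
      (hVmono P hP)
  have hbulk : ∀ P ∈ exterior n, 0 ≤ bulk l b p V φ P := by
    intro P hP
    have := hcoef P hP
    have := coneFun_pos hP
    unfold bulk
    positivity
  have hprod : ∀ k P, 0 ≤ cutoff k P * bulk l b p V φ P := by
    intro k P
    by_cases hP : P ∈ exterior n
    · exact mul_nonneg (cutoff_nonneg k P) (hbulk P hP)
    · simp [cutoff, hP]
  have hcont : ∀ k, 0 < k → Continuous fun P => cutoff k P * bulk l b p V φ P :=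
    fun k hk => continuous_cutoff_mul hk (continuousOn_bulk l b hp hφ hV)
  have hsupp : ∀ k, 0 < k → HasCompactSupport fun P => cutoff k P * bulk l b p V φ P :=
    fun k hk => (hasCompactSupport_cutoff hk).mul_right
  intro Q hQ
  by_contra hne
  obtain ⟨k, hk, hcut⟩ := exists_cutoff_pos hQ
  -- The nonlinear term alone is strictly positive where φ ≠ 0; the square may vanish.
  have hpos : 0 < bulk l b p V φ Q := by
    have := hcoef Q hQ
    have := coneFun_pos hQ
    have := abs_pos.2 hne
    unfold bulk
    positivity
  have hint : 0 < ∫ P, cutoff k P * bulk l b p V φ P :=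
    (hcont k hk).integral_pos_of_hasCompactSupport_nonneg_nonzero (hsupp k hk) (hprod k)
      (mul_pos hcut hpos).ne'
  have hle : ∀ m, k ≤ m → ∫ P, cutoff k P * bulk l b p V φ P ≤ C / m := by
    intro m hm
    have hm0 := hk.trans_le hm
    refine le_trans (MeasureTheory.integral_mono
      ((hcont k hk).integrable_of_hasCompactSupport (hsupp k hk))
      ((hcont m hm0).integrable_of_hasCompactSupport (hsupp m hm0)) fun P => ?_) (hC m hm0)
    by_cases hP : P ∈ exterior n
    · exact mul_le_mul_of_nonneg_right (cutoff_mono hk hm P) (hbulk P hP)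
    · simp [cutoff, hP]
  have hlim : Filter.Tendsto (fun m : ℝ => C / m) Filter.atTop (nhds 0) :=
    Filter.Tendsto.div_atTop tendsto_const_nhds Filter.tendsto_id
  have := ge_of_tendsto hlim ((Filter.eventually_ge_atTop k).mono hle)
  linarith
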